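/- **Setting.** There are $K\ge1$ arms. In each epoch $t=1,2,\dots$ one arm is pulled, and if it is arm $k$ a reward $X_{k,t}\sim\nu_k$ is observed; all $X_{k,t}$ are independent. Fix $\sigma>0$, $0\le\underline\alpha\le\bar\alpha$, $\Delta\ge 0$, $B>0$. A problem instance consists of reward laws $\nu_k$ with means $\mu_k$ and of auxiliary means $y_k\ge0$. Let $k^*$ be the best arm, $\mu^*=\mu_{k^*}=\max_k\mu_k$ and $\Delta_k=\mu^*-\mu_k$. Let $\mathcal S$ be the class of instances such that every $\nu_k$ is $\sigma^2$-sub-Gaussian, for every $k$ there is an (unknown) $\alpha_k\in[\underline\alpha,\bar\alpha]$ with $\alpha_k y_k=\mu_k$, the best arm is unique, $\Delta_k\ge\Delta$ for $k\ne k^*$, and $\Delta_k\le B$ for all $k$. Before epoch $t$, $h_{k,t}$ auxiliary observations of arm $k$ arrive, where $\mathbf H=(h_{k,t})$ is a fixed matrix of nonnegative integers with $h_{k,1}=1$ for all $k$. Auxiliary observations are noiseless: each one of arm $k$ equals $y_k$. A policy chooses the arm in epoch $t$ as a measurable function of the past actions and rewards, the averages of the auxiliary observations in epochs $1,\dots,t$,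 the numbers $h_{k,s}$, $s\le t$, and a random seed independent of the rewards. Let $\mathcal R^\pi(T)=\mathbb E\sum_{t=1}^T(\mu^*-\mu_{\pi_t})$, and let $n^\pi_{k,t}$ be the number of pulls of arm $k$ before epoch $t$. A policy $\pi$ is information-agnostic-optimal (IAO), with constant $C_\pi>0$, if $\mathbb E[n^\pi_{k,T+1}]\le \frac{C_\pi}{\Delta_k^2}\log T$ for every instance in $\mathcal S$, every $k\ne k^*$ and every $T\ge2$. The policy UCB1+ with parameter $c$ pulls each arm once in epochs $1,\dots,K$, and in each epoch $t>K$ pulls the arm (of smallest index in case of ties) that maximizes $$U_{k,t}=\min\Big\{\bar X_{k,t}+\sqrt{\tfrac{c\sigma^2\log t}{n_{k,t}}},\ \bar\alpha\,y_k\Big\},$$ where $\bar X_{k,t}$ is the average of the rewards of arm $k$ observed before epoch $t$ and $y_k$ is its auxiliary observation before epoch 1. **Theorem.** Let $c>2$. There are positive constants $C_1,C_2,C_3,C_4$ that depend only on $\sigma$, $c$ and $B$ such that for all $K,\underline\alpha,\bar\alpha,\Delta,\mathbf H$ as above: 1. For every instance in $\mathcal S$ and every $T\ge1$, $$\mathcal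 R^{\mathrm{UCB1+}}(T)\le\sum_{k\ne k^*,\ \bar\alpha y_k\ge\mu^*}\frac{C_1}{\Delta_k^2}\log T+C_2+\sum_{k}\Delta_k .$$ 2. UCB1+ is IAO, with constant $C_3$, and it is optimal among IAO policies in the following sense. Say that an instance in $\mathcal S$ has margin $\varepsilon$ if $\varepsilon>0$, $\varepsilon\ge\Delta$, and every $k\ne k^*$ satisfies $\varepsilon\le\Delta_k\le B-\varepsilon$ and either $\bar\alpha y_k<\mu^*$ or $\bar\alpha y_k\ge\mu^*+\varepsilon$. (a) For every instance in $\mathcal S$ with some margin, and with $\bar\alpha y_k\ge\mu^*$ for some $k\ne k^*$, there is $M>0$, independent of $T$ and of $\pi$, such that every IAO policy $\pi$ satisfies $\mathcal R^{\mathrm{UCB1+}}(T)\le M\,\mathcal R^{\pi}(T)$ for all sufficiently large $T$. (If there is no such $k$, then $\mathcal R^{\mathrm{UCB1+}}(T)$ is bounded in $T$ by part 1.) (b) For every instance in $\mathcal S$ with $\nu_k=\mathcal N(\mu_k,\sigma^2)$ for all $k$ and with margin $\varepsilon$, every IAO policy $\pi$ with constant $C_\pi$, and every $T\ge1$, $$\mathcal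 R^{\mathrm{UCB1+}}(T)\le C_4\Big(1+\log K+\log(1+C_\pi)+\log\big(1+\tfrac1\varepsilon\big)\Big)\Big(\mathcal R^{\pi}(T)+1+\sum_k\Delta_k+\sum_{k\ne k^*,\ \bar\alpha y_k\ge\mu^*}\frac1{\Delta_k}\Big).$$ -/

import Mathlib

open MeasureTheory ProbabilityTheory
open scoped NNReal

universe u

namespace AuxBandit

/-- The smallest index at which `f` attains its maximum. -/
noncomputable def firstArgmax {K : ℕ} [NeZero K] (f : Fin K → ℝ) : Fin K :=
  open Classical in
  (Finset.univ.filter fun k => ∀ j, f j ≤ f k).min' (by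
    obtain ⟨k, -, hk⟩ := Finset.exists_max_image (Finset.univ : Finset (Fin K)) f
      ⟨0, Finset.mem_univ _⟩
    exact ⟨k, by simpa using hk⟩)

theorem firstArgmax_eq_iff {K : ℕ} [NeZero K] (f : Fin K → ℝ) (k : Fin K) :
    firstArgmax f = k ↔ (∀ j, f j ≤ f k) ∧ ∀ i < k, ∃ j, f i < f j := by
  classical
  unfold firstArgmax
  rw [Finset.min'_eq_iff]
  simp only [Finset.mem_filter, Finset.mem_univ, true_and]
  refine and_congr_right fun _ => ⟨fun h i hi => ?_, fun h i hi => ?_⟩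
  · by_contra! hcon
    exact absurd (h i hcon) (not_le.mpr hi)
  · by_contra! hlt
    obtain ⟨j, hj⟩ := h i hlt
    exact absurd (hi j) (not_le.mpr hj)

theorem measurable_firstArgmax {K : ℕ} [NeZero K] :
    Measurable (firstArgmax : (Fin K → ℝ) → Fin K) := by
  refine measurable_to_countable' fun k => ?_
  have : (firstArgmax : (Fin K → ℝ) → Fin K) ⁻¹' {k} =
      (⋂ j, {f | f j ≤ f k}) ∩ ⋂ i, ⋂ (_ : i < k), ⋃ j, {f | f i < f j} := by
    ext f
    simp [firstArgmax_eq_iff]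
  rw [this]
  refine (MeasurableSet.iInter fun j =>
    measurableSet_le (measurable_pi_apply j) (measurable_pi_apply k)).inter
    (MeasurableSet.iInter fun i => MeasurableSet.iInter fun _ => MeasurableSet.iUnion fun j =>
      measurableSet_lt (measurable_pi_apply i) (measurable_pi_apply j))

/-- A problem instance: the reward laws `ν k` and the means `y k` of the auxiliary
observations. Auxiliary observations are noiseless, so an auxiliary observation of arm `k`
has the point mass at `y k` as its law. -/
structure Problem (K : ℕ) where
  ν : Fin K → ProbabilityMeasure ℝ
  y : Fin K → ℝ

namespace Problem

variable {K : ℕ} [NeZero K]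

/-- The mean reward of arm `k`. -/
noncomputable def mean (θ : Problem K) (k : Fin K) : ℝ := ∫ x, x ∂(θ.ν k : Measure ℝ)

/-- The best arm (smallest index in case of ties). -/
noncomputable def bestArm (θ : Problem K) : Fin K := firstArgmax θ.mean

/-- The best mean reward. -/
noncomputable def bestMean (θ : Problem K) : ℝ := θ.mean θ.bestArm

/-- The gap of arm `k`. -/
noncomputable def gap (θ : Problem K) (k : Fin K) : ℝ := θ.bestMean - θ.mean k

/-- The suboptimal arms whose optimistic estimate `ahi * y k` is at least the best mean. -/
noncomputable def contenders (θ : Problem K) (ahi : ℝ) : Finset (Fin K) :=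
  open Classical in
  Finset.univ.filter fun k => k ≠ θ.bestArm ∧ θ.bestMean ≤ ahi * θ.y k

end Problem

/-- The class of problem instances: `σ ^ 2`-sub-Gaussian rewards, nonnegative auxiliary means,
linear mappings with zero intercept and slopes in `[alo, ahi]`, a unique best arm, separation
at least `Δ`, and gaps at most `B`. -/
def problemClass (K : ℕ) [NeZero K] (σ : ℝ≥0) (alo ahi Δ B : ℝ) : Set (Problem K) :=
  {θ | (∀ k, HasSubgaussianMGF (fun x => x - θ.mean k) (σ ^ 2) (θ.ν k : Measure ℝ)) ∧
    (∀ k, 0 ≤ θ.y k) ∧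
    (∀ k, ∃ a ∈ Set.Icc alo ahi, a * θ.y k = θ.mean k) ∧
    (∀ k, k ≠ θ.bestArm → 0 < θ.gap k ∧ Δ ≤ θ.gap k) ∧
    ∀ k, θ.gap k ≤ B}

/-- An admissible policy. Time is counted from `0`, so `act t` is the choice in epoch `t + 1`.
Its arguments are the random seed, the past actions with the rewards they produced, the average
auxiliary observations of epochs `1, …, t + 1`, and the numbers of auxiliary arrivals in these
epochs. (The past actions are functions of the other data, so that listing them does not
enlarge the class of policies.) -/
structure Policy (K : ℕ) where
  Seed : Type u
  [mSeed : MeasurableSpace Seed]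
  seedLaw : Measure Seed
  [prob : IsProbabilityMeasure seedLaw]
  act : (t : ℕ) → Seed → (Fin t → Fin K × ℝ) → (Fin (t + 1) → Fin K → ℝ) →
    (Fin (t + 1) → Fin K → ℕ) → Fin K
  measurable_act : ∀ t, Measurable
    fun p : Seed × (Fin t → Fin K × ℝ) × (Fin (t + 1) → Fin K → ℝ) ×
      (Fin (t + 1) → Fin K → ℕ) => act t p.1 p.2.1 p.2.2.1 p.2.2.2

attribute [instance] Policy.mSeed Policy.prob

/-- The average of the auxiliary observations of arm `k` before epoch `t + 1` when `H t k` of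
them arrive: each equals `y k`, and the average of no observation is `0`. -/
noncomputable def auxMean {K : ℕ} (H : ℕ → Fin K → ℕ) (y : Fin K → ℝ) (t : ℕ) (k : Fin K) : ℝ :=
  (∑ _m : Fin (H t k), y k) / (max 1 (H t k) : ℕ)

namespace Policy

variable {K : ℕ}

/-- The arm played at time `t` when the arrival matrix is `H`, the auxiliary means are `y`,
the seed is `u` and `X t k` is the reward that arm `k` yields at time `t`. -/
noncomputable def play (π : Policy K) (H : ℕ → Fin K → ℕ) (y : Fin K → ℝ)
    (u : π.Seed) (X : ℕ → Fin K → ℝ) (t : ℕ) : Fin K :=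
  π.act t u (fun s : Fin t => (play π H y u X s, X s (play π H y u X s)))
    (fun s k => auxMean H y s k) (fun s k => H s k)
termination_by t
decreasing_by all_goals exact s.2

/-- The joint law of the seed and of the rewards `X t k`, which are independent over all times
and arms, with `X t k` distributed according to `ν k`. -/
noncomputable def law (π : Policy K) (θ : Problem K) :
    Measure (π.Seed × (ℕ → Fin K → ℝ)) :=
  π.seedLaw.prod
    (Measure.infinitePi fun _ : ℕ => Measure.pi fun k : Fin K => (θ.ν k : Measure ℝ))

/-- The expected number of pulls of arm `k` in the first `T` epochs. -/
noncomputable def expectedPulls (π : Policy K) (H : ℕ → Fin K → ℕ) (θ : Problem K)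
    (k : Fin K) (T : ℕ) : ℝ :=
  ∫ ω, ∑ t ∈ Finset.range T, (if π.play H θ.y ω.1 ω.2 t = k then (1 : ℝ) else 0) ∂(π.law θ)

/-- The expected regret over the first `T` epochs. -/
noncomputable def regret [NeZero K] (π : Policy K) (H : ℕ → Fin K → ℕ) (θ : Problem K)
    (T : ℕ) : ℝ :=
  ∫ ω, ∑ t ∈ Finset.range T, (θ.bestMean - θ.mean (π.play H θ.y ω.1 ω.2 t)) ∂(π.law θ)

/-- Under the arrival matrix `H`, the policy pulls each suboptimal arm `k` at most
`C / gap ^ 2 * log T` times in expectation, for every instance of the class `S` and `T ≥ 2`. -/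
def IsIAOWith [NeZero K] (π : Policy K) (H : ℕ → Fin K → ℕ) (S : Set (Problem K)) (C : ℝ) :
    Prop :=
  ∀ θ ∈ S, ∀ k, k ≠ θ.bestArm → ∀ T : ℕ, 2 ≤ T →
    π.expectedPulls H θ k T ≤ C / θ.gap k ^ 2 * Real.log T

/-- Information-agnostic-optimal policies over the class `S`. -/
def IsIAO [NeZero K] (π : Policy K) (H : ℕ → Fin K → ℕ) (S : Set (Problem K)) : Prop :=
  ∃ C : ℝ, 0 < C ∧ π.IsIAOWith H S C

end Policy

/-- The number of pulls of arm `k` in a history. -/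
noncomputable def pullCount {K t : ℕ} (hist : Fin t → Fin K × ℝ) (k : Fin K) : ℝ :=
  ∑ s, if (hist s).1 = k then 1 else 0

/-- The empirical mean reward of arm `k` in a history. -/
noncomputable def empMean {K t : ℕ} (hist : Fin t → Fin K × ℝ) (k : Fin K) : ℝ :=
  (∑ s, if (hist s).1 = k then (hist s).2 else 0) / max 1 (pullCount hist k)

/-- The capped upper confidence bound of arm `k` in epoch `t + 1`, where `a` is the auxiliary
observation of arm `k` before the first epoch. -/
noncomputable def cappedUCB {K : ℕ} (σ : ℝ≥0) (ahi c : ℝ) (t : ℕ) (hist : Fin t → Fin K × ℝ)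
    (k : Fin K) (a : ℝ) : ℝ :=
  min (empMean hist k + Real.sqrt (c * (σ : ℝ) ^ 2 * Real.log (t + 1) / pullCount hist k))
    (ahi * a)

theorem measurable_pullCount {K t : ℕ} (k : Fin K) :
    Measurable fun hist : Fin t → Fin K × ℝ => pullCount hist k := by
  unfold pullCount
  refine Finset.measurable_sum _ fun s _ => Measurable.ite ?_ measurable_const measurable_const
  exact (measurable_fst.comp (measurable_pi_apply s)) (measurableSet_singleton k)

theorem measurable_empMean {K t : ℕ} (k : Fin K) :
    Measurable fun hist : Fin t → Fin K × ℝ => empMean hist k := by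
  unfold empMean
  refine Measurable.div (Finset.measurable_sum _ fun s _ => Measurable.ite ?_ ?_ measurable_const)
    (measurable_const.max (measurable_pullCount k))
  · exact (measurable_fst.comp (measurable_pi_apply s)) (measurableSet_singleton k)
  · exact measurable_snd.comp (measurable_pi_apply s)

/-- UCB1+: pull each arm once in the first `K` epochs, then the arm with the largest capped
upper confidence bound. No randomization is used. -/
noncomputable def ucb1Plus (K : ℕ) [NeZero K] (σ : ℝ≥0) (ahi c : ℝ) : Policy.{u} K where
  Seed := PUnit.{u + 1}
  seedLaw := Measure.dirac PUnit.unit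
  act t _ hist aux _ :=
    if h : t < K then ⟨t, h⟩
    else firstArgmax fun k => cappedUCB σ ahi c t hist k (aux 0 k)
  measurable_act t := by
    by_cases h : t < K
    · simp only [h, dite_true]
      exact measurable_const
    · simp only [h, dite_false]
      refine measurable_firstArgmax.comp (measurable_pi_lambda _ fun k => ?_)
      have h1 : Measurable fun p : PUnit.{u + 1} × (Fin t → Fin K × ℝ) ×
          (Fin (t + 1) → Fin K → ℝ) × (Fin (t + 1) → Fin K → ℕ) => p.2.1 :=
        measurable_fst.comp measurable_snd
      have h2 : Measurable fun p : PUnit.{u + 1} × (Fin t → Fin K × ℝ) ×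
          (Fin (t + 1) → Fin K → ℝ) × (Fin (t + 1) → Fin K → ℕ) => p.2.2.1 0 k :=
        (measurable_pi_apply k).comp ((measurable_pi_apply 0).comp
          (measurable_fst.comp (measurable_snd.comp measurable_snd)))
      unfold cappedUCB
      refine Measurable.min (Measurable.add ((measurable_empMean k).comp h1) ?_)
        (h2.const_mul ahi)
      exact Real.continuous_sqrt.measurable.comp
        (Measurable.div measurable_const ((measurable_pullCount k).comp h1))

/-- The instance `θ` has margin `ε` in its class: the gaps are at least `ε`, each suboptimal
arm's optimistic estimate is below the best mean or exceeds it by at least `ε`, and the best mean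
can be raised by `ε` without leaving the range `[Δ, B]` of allowed gaps. -/
def HasMargin {K : ℕ} [NeZero K] (θ : Problem K) (ahi Δ B ε : ℝ) : Prop :=
  0 < ε ∧ Δ ≤ ε ∧ ∀ k, k ≠ θ.bestArm →
    ε ≤ θ.gap k ∧ θ.gap k + ε ≤ B ∧
      (ahi * θ.y k < θ.bestMean ∨ θ.bestMean + ε ≤ ahi * θ.y k)

end AuxBandit

/-! Upper bound. A cap `ahi * y k` never lies below the mean of arm `k`, so the capped index of the
best arm is at least `bestMean` unless its confidence bound fails. Outside such failures a pull of a
suboptimal arm `k` forces `bestMean ≤ ahi * y k`: only contenders are pulled. After order `log T /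
gap ^ 2` pulls, a contender is pulled again only if its empirical mean is too high by half the gap
(`contender_of_play`). Such overestimates cost a bounded expected number of pulls, and the failure
probabilities are summable because `2 < c`. Both facts come from one object, the product of weights
of mean at most `1` over the observed rewards of an arm. It is a nonnegative supermartingale
(`sum_obsWeight_le`), which copes with the random sample sizes; peeling over scales of the sample
size treats the square-root boundary.

Lower bound. The auxiliary data depend on `y` and `H` only. Under a margin, the law of a contender
`k` can be replaced by one of mean `bestMean + ε` with `y` untouched: the instance stays in the
class, the auxiliary data do not reveal the change, and `k` is now best. An IAO policy must then
pull `k` in all but order `log T` epochs in expectation. By the change of measure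
`exp_neg_le_measureReal` this is possible only if, in the original instance, `k` receives order `log
T` pulls, divided by the information cost of the change (`pulls_lower_bound`).

For Gaussian rewards the cost is `(gap + ε) ^ 2 / (2 * σ ^ 2)`, at most `2 * gap ^ 2 / σ ^ 2`, which
matches the upper bound arm by arm. For other laws the difficulty is to find an alternative with the
same variance proxy at finite cost; `exists_subgaussian_alternative` builds one as a mixture of a
damped copy of the law and an atom. The resulting rate depends on the instance but not on the
policy. -/

namespace AuxBandit

/-! ### Resampling one row of an infinite product measure -/

section Resampling

variable {S E : Type*} [MeasurableSpace S] [MeasurableSpace E]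

theorem measurable_update_uncurry (t : ℕ) :
    Measurable fun p : (ℕ → E) × E => Function.update p.1 t p.2 := by
  refine measurable_pi_lambda _ fun i => ?_
  by_cases h : i = t
  · subst h
    simpa using measurable_snd
  · simp only [Function.update_of_ne h]
    exact (measurable_pi_apply i).comp measurable_fst

/-- Resampling one coordinate of a product measure replaces the corresponding factor. -/
theorem map_update_infinitePi (μ μ' : ℕ → Measure E) [∀ i, IsProbabilityMeasure (μ i)]
    [∀ i, IsProbabilityMeasure (μ' i)] (t : ℕ) (hμ : ∀ i, i ≠ t → μ' i = μ i) :
    ((Measure.infinitePi μ).prod (μ' t)).map (fun p => Function.update p.1 t p.2) =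
      Measure.infinitePi μ' := by
  refine Measure.eq_infinitePi _ fun s B hB => ?_
  classical
  rw [Measure.map_apply (measurable_update_uncurry t)
    (MeasurableSet.pi s.countable_toSet fun i _ => hB i)]
  have hpre : (fun p : (ℕ → E) × E => Function.update p.1 t p.2) ⁻¹' (Set.pi s B) =
      (Set.pi (s.erase t : Finset ℕ) B) ×ˢ (if t ∈ s then B t else Set.univ) := by
    ext ⟨X, x⟩
    simp only [Set.mem_preimage, Set.mem_pi, Set.mem_prod, Finset.mem_coe, Finset.mem_erase]
    constructor
    · intro h
      refine ⟨fun i hi => by simpa [Function.update_of_ne hi.1] using h i hi.2, ?_⟩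
      split_ifs with ht
      · simpa using h t ht
      · trivial
    · rintro ⟨h1, h2⟩ i hi
      by_cases hit : i = t
      · subst hit
        simpa [hi] using h2
      · simpa [Function.update_of_ne hit] using h1 i ⟨hit, hi⟩
  rw [hpre, Measure.prod_prod, Measure.infinitePi_pi _ (fun i _ => hB i),
    Finset.prod_congr rfl fun i hi => by rw [← hμ i (Finset.ne_of_mem_erase hi)]]
  split_ifs with ht
  · rw [Finset.prod_erase_mul _ _ ht]
  · rw [Finset.erase_eq_of_notMem ht]
    simp

/-- The old entry at `t` is discarded, so the two families may differ there. With `μ' = μ` this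
plays the role of conditioning on the other rows; with `μ' ≠ μ` it exchanges the law of one row. -/
theorem lintegral_resample (P : Measure S) [SFinite P] (μ μ' : ℕ → Measure E)
    [∀ i, IsProbabilityMeasure (μ i)] [∀ i, IsProbabilityMeasure (μ' i)] (t : ℕ)
    (hμ : ∀ i, i ≠ t → μ' i = μ i) {F : S × (ℕ → E) → ENNReal} (hF : Measurable F) :
    ∫⁻ ω, F ω ∂(P.prod (Measure.infinitePi μ')) =
      ∫⁻ ω, ∫⁻ x, F (ω.1, Function.update ω.2 t x) ∂(μ' t) ∂(P.prod (Measure.infinitePi μ)) := by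
  have hG : Measurable fun p : (S × (ℕ → E)) × E => F (p.1.1, Function.update p.1.2 t p.2) :=
    hF.comp ((measurable_fst.comp measurable_fst).prodMk
      ((measurable_update_uncurry t).comp
        ((measurable_snd.comp measurable_fst).prodMk measurable_snd)))
  rw [lintegral_prod _ hF.aemeasurable, lintegral_prod _ hG.lintegral_prod_right'.aemeasurable]
  refine lintegral_congr fun s => ?_
  have hFs : Measurable fun X => F (s, X) := hF.comp measurable_prodMk_left
  conv_lhs => rw [← map_update_infinitePi μ μ' t hμ]
  rw [lintegral_map hFs (measurable_update_uncurry t), lintegral_prod]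
  exact (hFs.comp (measurable_update_uncurry t)).aemeasurable

theorem lintegral_congr_rows (P : Measure S) [SFinite P] (μ μ' : ℕ → Measure E)
    [∀ i, IsProbabilityMeasure (μ i)] [∀ i, IsProbabilityMeasure (μ' i)] [Nonempty E] (T : ℕ)
    (hμ : ∀ i < T, μ i = μ' i) {F : S × (ℕ → E) → ENNReal} (hF : Measurable F)
    (hdep : ∀ s X X', (∀ i < T, X i = X' i) → F (s, X) = F (s, X')) :
    ∫⁻ ω, F ω ∂(P.prod (Measure.infinitePi μ)) = ∫⁻ ω, F ω ∂(P.prod (Measure.infinitePi μ')) := by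
  classical
  rw [lintegral_prod _ hF.aemeasurable, lintegral_prod _ hF.aemeasurable]
  refine lintegral_congr fun s => ?_
  obtain ⟨e⟩ := ‹Nonempty E›
  -- Padding the first `T` rows with an arbitrary `e` makes `F` a function of finitely many
  -- coordinates without changing its value.
  let ext : ((i : Finset.range T) → E) → ℕ → E := fun z i =>
    if h : i ∈ Finset.range T then z ⟨i, h⟩ else e
  have hext : Measurable ext := by
    refine measurable_pi_lambda _ fun i => ?_
    by_cases h : i ∈ Finset.range T
    · simpa only [ext, h, dite_true] using measurable_pi_apply _
    · simp only [ext, h, dite_false]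
      exact measurable_const
  have hFe : Measurable fun z => F (s, ext z) :=
    (hF.comp measurable_prodMk_left).comp hext
  have key : ∀ X, F (s, X) = F (s, ext ((Finset.range T).restrict X)) := fun X => by
    refine hdep s _ _ fun i hi => ?_
    simp [ext, hi]
  rw [lintegral_congr key, lintegral_congr key]
  have hres := fun (m : ℕ → Measure E) (_ : ∀ i, IsProbabilityMeasure (m i)) =>
    lintegral_restrict_infinitePi (μ := m) (s := Finset.range T) hFe
  rw [hres μ inferInstance, hres μ' inferInstance]
  congr 2
  funext i
  exact hμ _ (Finset.mem_range.mp i.2)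

end Resampling

/-! ### Runs of a policy: dependence on the past, measurability, likelihood weights -/

namespace Policy

variable {K : ℕ} (π : Policy.{u} K) (H : ℕ → Fin K → ℕ) (y : Fin K → ℝ)

/-- The arm played depends on the past rewards only through the observed ones. -/
theorem play_congr (u : π.Seed) {X X' : ℕ → Fin K → ℝ} (t : ℕ)
    (h : ∀ s < t, X s (π.play H y u X s) = X' s (π.play H y u X s)) :
    π.play H y u X t = π.play H y u X' t := by
  induction t using Nat.strong_induction_on with
  | _ t ih =>
    have hs : ∀ s < t, π.play H y u X s = π.play H y u X' s := fun s hst =>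
      ih s hst fun r hr => h r (hr.trans hst)
    rw [play, play]
    congr 1
    funext s
    exact Prod.ext (hs s s.2) (by simpa only [← hs s s.2] using h s s.2)

theorem play_congr_of_lt (u : π.Seed) {X X' : ℕ → Fin K → ℝ} (t : ℕ)
    (h : ∀ s < t, X s = X' s) : π.play H y u X t = π.play H y u X' t :=
  π.play_congr H y u t fun s hs => by rw [h s hs]

theorem play_update_of_le (u : π.Seed) (X : ℕ → Fin K → ℝ) {s t : ℕ} (hst : s ≤ t)
    (x : Fin K → ℝ) : π.play H y u (Function.update X t x) s = π.play H y u X s :=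
  π.play_congr_of_lt H y u s fun r hr => by
    rw [Function.update_of_ne (hr.trans_le hst).ne]

theorem measurable_play (t : ℕ) :
    Measurable fun ω : π.Seed × (ℕ → Fin K → ℝ) => π.play H y ω.1 ω.2 t := by
  induction t using Nat.strong_induction_on with
  | _ t ih =>
    have hrow : ∀ s, Measurable fun ω : π.Seed × (ℕ → Fin K → ℝ) => ω.2 s := fun s =>
      (measurable_pi_apply s).comp measurable_snd
    have heq : (fun ω : π.Seed × (ℕ → Fin K → ℝ) => π.play H y ω.1 ω.2 t) = fun ω =>
        π.act t ω.1 (fun s : Fin t => (π.play H y ω.1 ω.2 s, ω.2 s (π.play H y ω.1 ω.2 s)))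
          (fun s k => auxMean H y s k) (fun s k => H s k) := by
      funext ω
      rw [play]
    rw [heq]
    refine (π.measurable_act t).comp (measurable_fst.prodMk (Measurable.prodMk ?_
      (measurable_const (a := ((fun (s : Fin (t + 1)) (k : Fin K) => auxMean H y s k),
        fun (s : Fin (t + 1)) (k : Fin K) => H s k)))))
    refine measurable_pi_lambda _ fun s => (ih s s.2).prodMk ?_
    have hev : Measurable fun p : Fin K × (Fin K → ℝ) => p.2 p.1 :=
      measurable_from_prod_countable_right fun k => measurable_pi_apply k
    exact hev.comp ((ih s s.2).prodMk (hrow s))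

theorem measurableSet_play_eq (t : ℕ) (k : Fin K) :
    MeasurableSet {ω : π.Seed × (ℕ → Fin K → ℝ) | π.play H y ω.1 ω.2 t = k} :=
  π.measurable_play H y t (measurableSet_singleton k)

instance (θ : Problem K) : IsProbabilityMeasure (π.law θ) := by
  unfold law
  infer_instance

theorem measurable_reward (t : ℕ) (k : Fin K) :
    Measurable fun ω : π.Seed × (ℕ → Fin K → ℝ) => ω.2 t k :=
  (measurable_pi_apply k).comp ((measurable_pi_apply t).comp measurable_snd)

/-- The product of the weights `f` of the observed rewards of arm `k` before time `t`. -/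
noncomputable def obsWeight (k : Fin K) (f : ℝ → ENNReal) (ω : π.Seed × (ℕ → Fin K → ℝ))
    (t : ℕ) : ENNReal :=
  ∏ s ∈ Finset.range t, if π.play H y ω.1 ω.2 s = k then f (ω.2 s k) else 1

theorem measurable_obsWeight (k : Fin K) {f : ℝ → ENNReal} (hf : Measurable f) (t : ℕ) :
    Measurable fun ω => π.obsWeight H y k f ω t := by
  unfold obsWeight
  exact Finset.measurable_prod _ fun s _ => Measurable.ite (π.measurableSet_play_eq H y s k)
    (hf.comp (π.measurable_reward s k)) measurable_const

theorem obsWeight_update_of_le (k : Fin K) (f : ℝ → ENNReal) (ω : π.Seed × (ℕ → Fin K → ℝ))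
    {s t : ℕ} (hst : s ≤ t) (x : Fin K → ℝ) :
    π.obsWeight H y k f (ω.1, Function.update ω.2 t x) s = π.obsWeight H y k f ω s := by
  unfold obsWeight
  refine Finset.prod_congr rfl fun r hr => ?_
  have hr' := Finset.mem_range.mp hr
  simp only [π.play_update_of_le H y _ _ (hr'.le.trans hst),
    Function.update_of_ne (hr'.trans_le hst).ne]

theorem lintegral_coord (ν : Fin K → ProbabilityMeasure ℝ) (k : Fin K) {f : ℝ → ENNReal}
    (hf : Measurable f) :
    ∫⁻ x, f (x k) ∂(Measure.pi fun k => (ν k : Measure ℝ)) = ∫⁻ x, f x ∂(ν k : Measure ℝ) :=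
  (measurePreserving_eval (fun k => (ν k : Measure ℝ)) k).lintegral_comp hf

/-- Weights of mass at most `q` lose the factor `q` at each pull. -/
theorem sum_obsWeight_le (θ : Problem K) (k : Fin K) {f : ℝ → ENNReal} (hf : Measurable f)
    {q : ENNReal} (hq1 : q ≤ 1) (hq : ∫⁻ x, f x ∂(θ.ν k : Measure ℝ) ≤ q) (T : ℕ) :
    (1 - q) * ∑ t ∈ Finset.range T,
        ∫⁻ ω, (if π.play H y ω.1 ω.2 t = k then π.obsWeight H y k f ω t else 0) ∂(π.law θ) +
      ∫⁻ ω, π.obsWeight H y k f ω T ∂(π.law θ) ≤ 1 := by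
  classical
  induction T with
  | zero => simp [obsWeight]
  | succ T ih =>
    refine le_trans ?_ ih
    rw [Finset.sum_range_succ, mul_add, add_assoc]
    refine add_le_add le_rfl ?_
    have hstep : ∫⁻ ω, π.obsWeight H y k f ω (T + 1) ∂(π.law θ) ≤
        ∫⁻ ω, (π.obsWeight H y k f ω T * if π.play H y ω.1 ω.2 T = k then q else 1)
          ∂(π.law θ) := by
      unfold law
      -- Row `T` is redrawn from its own law. The weight up to `T` and the arm played at `T` do not
      -- see it, so only the new factor is integrated; a pull then multiplies the mass by at most
      -- `q`.
      rw [lintegral_resample _ _ _ T (fun _ _ => rfl) (π.measurable_obsWeight H y k hf (T + 1))]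
      refine lintegral_mono fun ω => ?_
      have : ∀ x, π.obsWeight H y k f (ω.1, Function.update ω.2 T x) (T + 1) =
          π.obsWeight H y k f ω T * if π.play H y ω.1 ω.2 T = k then f (x k) else 1 := fun x => by
        conv_lhs => unfold obsWeight
        rw [Finset.prod_range_succ]
        congr 1
        · exact π.obsWeight_update_of_le H y k f ω le_rfl x
        · simp [π.play_update_of_le H y _ _ le_rfl]
      simp_rw [this]
      have hm : Measurable fun x : Fin K → ℝ =>
          if π.play H y ω.1 ω.2 T = k then f (x k) else 1 :=
        Measurable.ite (.const _) (hf.comp (measurable_pi_apply k)) measurable_const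
      rw [lintegral_const_mul _ hm]
      refine mul_le_mul_right ?_ _
      split_ifs
      · rw [lintegral_coord θ.ν k hf]
        exact hq
      · simp
    calc _ ≤ (1 - q) * ∫⁻ ω, (if π.play H y ω.1 ω.2 T = k then π.obsWeight H y k f ω T else 0)
            ∂(π.law θ) + _ := add_le_add le_rfl hstep
      _ = ∫⁻ ω, π.obsWeight H y k f ω T ∂(π.law θ) := by
          have hm := π.measurable_obsWeight H y k hf T
          rw [← lintegral_const_mul _ (Measurable.ite (π.measurableSet_play_eq H y T k) hm
            measurable_const), ← lintegral_add_left]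
          · refine lintegral_congr fun ω => ?_
            split_ifs
            · rw [mul_comm, ← mul_add, tsub_add_cancel_of_le hq1, mul_one]
            · simp
          · exact (Measurable.ite (π.measurableSet_play_eq H y T k) hm
              measurable_const).const_mul _

theorem lintegral_obsWeight_le_one (θ : Problem K) (k : Fin K) {f : ℝ → ENNReal}
    (hf : Measurable f) (hf1 : ∫⁻ x, f x ∂(θ.ν k : Measure ℝ) ≤ 1) (T : ℕ) :
    ∫⁻ ω, π.obsWeight H y k f ω T ∂(π.law θ) ≤ 1 := by
  simpa using π.sum_obsWeight_le H y θ k hf le_rfl hf1 T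

/-- If `f` times the law of arm `k` is dominated by its law in `θ'`, and the other laws agree,
then the likelihood weights dominate likewise on functions of the observed rewards. -/
theorem lintegral_mul_obsWeight_le (θ θ' : Problem K) (k : Fin K) {f : ℝ → ENNReal}
    (hf : Measurable f) (hν : ∀ j, j ≠ k → θ.ν j = θ'.ν j)
    (hdom : (θ.ν k : Measure ℝ).withDensity f ≤ (θ'.ν k : Measure ℝ)) (T : ℕ)
    {G : π.Seed × (ℕ → Fin K → ℝ) → ENNReal} (hG : Measurable G)
    (hdep : ∀ u X X', (∀ t < T, X t (π.play H y u X t) = X' t (π.play H y u X t)) →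
      G (u, X) = G (u, X')) :
    ∫⁻ ω, G ω * π.obsWeight H y k f ω T ∂(π.law θ) ≤ ∫⁻ ω, G ω ∂(π.law θ') := by
  classical
  let pν : Measure (Fin K → ℝ) := Measure.pi fun k => (θ.ν k : Measure ℝ)
  let pν' : Measure (Fin K → ℝ) := Measure.pi fun k => (θ'.ν k : Measure ℝ)
  -- Hybrid argument: rows before `j` follow `θ`, the others `θ'`. Moving one more row to `θ`
  -- together with its likelihood factor can only lower the integral.
  let mix : ℕ → ℕ → Measure (Fin K → ℝ) := fun j i => if i < j then pν else pν'
  have hprob : ∀ j i, IsProbabilityMeasure (mix j i) := fun j i => by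
    simp only [mix]
    split_ifs <;> infer_instance
  have hGW : ∀ j, Measurable fun ω => G ω * π.obsWeight H y k f ω j := fun j =>
    hG.mul (π.measurable_obsWeight H y k hf j)
  have main : ∀ j ≤ T, ∫⁻ ω, G ω * π.obsWeight H y k f ω j
      ∂(π.seedLaw.prod (Measure.infinitePi (mix j))) ≤ ∫⁻ ω, G ω ∂(π.law θ') := by
    intro j
    induction j with
    | zero => simp [obsWeight, mix, pν', law]
    | succ j ih =>
      intro hj
      refine le_trans ?_ (ih (by omega))
      rw [lintegral_resample π.seedLaw (mix j) (mix (j + 1)) j _ (hGW (j + 1)),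
        lintegral_resample π.seedLaw (mix j) (mix j) j (fun _ _ => rfl) (hGW j)]
      swap
      · intro i hi
        simp only [mix]
        have : i < j + 1 ↔ i < j := by omega
        simp only [this]
      refine lintegral_mono fun ω => ?_
      have e1 : mix (j + 1) j = pν := by simp [mix]
      have e2 : mix j j = pν' := by simp [mix]
      rw [e1, e2]
      obtain ⟨u, X⟩ := ω
      set a := π.play H y u X j with ha
      -- Only the entry of the played arm `a` in row `j` is observed, so a constant row carries the
      -- same information and `G` becomes a function of one real variable.
      let h : ℝ → ENNReal := fun r => G (u, Function.update X j fun _ => r)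
      have hh : Measurable h := by
        refine hG.comp (measurable_const.prodMk ?_)
        exact (measurable_update_uncurry j).comp (measurable_const.prodMk
          (measurable_pi_lambda _ fun _ => measurable_id))
      have hGh : ∀ x : Fin K → ℝ, G (u, Function.update X j x) = h (x a) := fun x => by
        refine hdep _ _ _ fun t _ => ?_
        by_cases htj : t = j
        · subst htj
          simp [π.play_update_of_le H y u X le_rfl, ← ha]
        · simp [Function.update_of_ne htj]
      have hWj : ∀ x : Fin K → ℝ, π.obsWeight H y k f (u, Function.update X j x) j =
          π.obsWeight H y k f (u, X) j := fun x =>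
        π.obsWeight_update_of_le H y k f (u, X) le_rfl x
      have hWj1 : ∀ x : Fin K → ℝ, π.obsWeight H y k f (u, Function.update X j x) (j + 1) =
          π.obsWeight H y k f (u, X) j * if a = k then f (x k) else 1 := fun x => by
        rw [← hWj x]
        conv_lhs => unfold obsWeight
        rw [Finset.prod_range_succ]
        simp [obsWeight, π.play_update_of_le H y u X le_rfl, ← ha]
      simp only [hGh, hWj, hWj1]
      by_cases hak : a = k
      · simp only [hak, if_true]
        have hl : ∀ x : Fin K → ℝ, h (x k) * (π.obsWeight H y k f (u, X) j * f (x k)) =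
            π.obsWeight H y k f (u, X) j * (f (x k) * h (x k)) := fun x => by ring
        simp only [hl, mul_comm (h _) (π.obsWeight H y k f (u, X) j)]
        have hfh : Measurable fun r => f r * h r := hf.mul hh
        have m1 : Measurable fun x : Fin K → ℝ => f (x k) * h (x k) :=
          hfh.comp (measurable_pi_apply k)
        have m2 : Measurable fun x : Fin K → ℝ => h (x k) := hh.comp (measurable_pi_apply k)
        rw [lintegral_const_mul _ m1, lintegral_const_mul _ m2,
          lintegral_coord θ.ν k hfh, lintegral_coord θ'.ν k hh]
        refine mul_le_mul_right ?_ _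
        have := lintegral_withDensity_eq_lintegral_mul (θ.ν k : Measure ℝ) hf hh
        exact this.symm.le.trans (lintegral_mono' hdom le_rfl)
      · simp only [hak, if_false, mul_one, mul_comm (h _)]
        have m2 : Measurable fun x : Fin K → ℝ => h (x a) := hh.comp (measurable_pi_apply a)
        rw [lintegral_const_mul _ m2, lintegral_const_mul _ m2,
          lintegral_coord θ.ν a hh, lintegral_coord θ'.ν a hh, hν a hak]
  refine le_trans (le_of_eq ?_) (main T le_rfl)
  unfold law
  refine lintegral_congr_rows _ _ _ T (fun i hi => ?_) (hGW T) fun u X X' hX => ?_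
  · simp [mix, hi, pν]
  · rw [hdep u X X' fun t ht => by rw [hX t ht]]
    congr 1
    unfold obsWeight
    refine Finset.prod_congr rfl fun s hs => ?_
    have hs' := Finset.mem_range.mp hs
    simp only [hX s hs', π.play_congr_of_lt H y u s fun r hr => hX r (hr.trans hs')]

/-! ### Sums over observed rewards, Wald's identity, change of measure -/

/-- The sum of `g` over the observed rewards of arm `k` before time `t`. -/
noncomputable def obsSum (k : Fin K) (g : ℝ → ℝ) (ω : π.Seed × (ℕ → Fin K → ℝ)) (t : ℕ) : ℝ :=
  ∑ s ∈ Finset.range t, if π.play H y ω.1 ω.2 s = k then g (ω.2 s k) else 0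

/-- The number of pulls of arm `k` before time `t`. -/
noncomputable def pulls (k : Fin K) (ω : π.Seed × (ℕ → Fin K → ℝ)) (t : ℕ) : ℝ :=
  ∑ s ∈ Finset.range t, if π.play H y ω.1 ω.2 s = k then (1 : ℝ) else 0

theorem obsSum_affine (k : Fin K) (g : ℝ → ℝ) (a b : ℝ) (ω : π.Seed × (ℕ → Fin K → ℝ)) (t : ℕ) :
    π.obsSum H y k (fun x => a * g x + b) ω t =
      a * π.obsSum H y k g ω t + b * π.pulls H y k ω t := by
  simp only [obsSum, pulls, Finset.mul_sum, ← Finset.sum_add_distrib]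
  refine Finset.sum_congr rfl fun s _ => ?_
  split_ifs <;> simp

theorem pulls_nonneg (k : Fin K) (ω : π.Seed × (ℕ → Fin K → ℝ)) (t : ℕ) :
    0 ≤ π.pulls H y k ω t :=
  Finset.sum_nonneg fun s _ => by split_ifs <;> simp

theorem pulls_le (k : Fin K) (ω : π.Seed × (ℕ → Fin K → ℝ)) (t : ℕ) :
    π.pulls H y k ω t ≤ t := by
  refine (Finset.sum_le_card_nsmul _ _ 1 fun s _ => by split_ifs <;> simp).trans ?_
  simp

theorem measurable_pulls (k : Fin K) (t : ℕ) : Measurable fun ω => π.pulls H y k ω t :=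
  Finset.measurable_sum _ fun s _ => Measurable.ite (π.measurableSet_play_eq H y s k)
    measurable_const measurable_const

theorem measurable_obsSum (k : Fin K) {g : ℝ → ℝ} (hg : Measurable g) (t : ℕ) :
    Measurable fun ω => π.obsSum H y k g ω t :=
  Finset.measurable_sum _ fun s _ => Measurable.ite (π.measurableSet_play_eq H y s k)
    (hg.comp (π.measurable_reward s k)) measurable_const

theorem pulls_congr (k : Fin K) (u : π.Seed) {X X' : ℕ → Fin K → ℝ} (T : ℕ)
    (h : ∀ t < T, X t (π.play H y u X t) = X' t (π.play H y u X t)) :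
    π.pulls H y k (u, X) T = π.pulls H y k (u, X') T := by
  refine Finset.sum_congr rfl fun s hs => ?_
  have hs' := Finset.mem_range.mp hs
  simp only [π.play_congr H y u s fun r hr => h r (hr.trans hs')]

theorem sum_pulls (ω : π.Seed × (ℕ → Fin K → ℝ)) (t : ℕ) :
    ∑ k, π.pulls H y k ω t = t := by
  unfold pulls
  rw [Finset.sum_comm]
  simp

theorem obsWeight_exp (k : Fin K) (g : ℝ → ℝ) (ω : π.Seed × (ℕ → Fin K → ℝ)) (t : ℕ) :
    π.obsWeight H y k (fun x => ENNReal.ofReal (Real.exp (g x))) ω t =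
      ENNReal.ofReal (Real.exp (π.obsSum H y k g ω t)) := by
  unfold obsWeight obsSum
  rw [Real.exp_sum, ENNReal.ofReal_prod_of_nonneg fun _ _ => (Real.exp_pos _).le]
  refine Finset.prod_congr rfl fun s _ => ?_
  split_ifs <;> simp

theorem integrable_pulls (θ : Problem K) (k : Fin K) (t : ℕ) :
    Integrable (fun ω => π.pulls H y k ω t) (π.law θ) := by
  refine Integrable.of_bound (π.measurable_pulls H y k t).aestronglyMeasurable t
    (Filter.Eventually.of_forall fun ω => ?_)
  rw [Real.norm_of_nonneg (π.pulls_nonneg H y k ω t)]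
  exact π.pulls_le H y k ω t

theorem expectedPulls_eq (θ : Problem K) (k : Fin K) (T : ℕ) :
    π.expectedPulls H θ k T = ∫ ω, π.pulls H θ.y k ω T ∂(π.law θ) := rfl

theorem expectedPulls_nonneg (θ : Problem K) (k : Fin K) (T : ℕ) :
    0 ≤ π.expectedPulls H θ k T :=
  integral_nonneg fun ω => π.pulls_nonneg H θ.y k ω T

theorem sum_expectedPulls (θ : Problem K) (T : ℕ) : ∑ k, π.expectedPulls H θ k T = T := by
  simp_rw [expectedPulls_eq]
  rw [← integral_finsetSum _ fun k _ => π.integrable_pulls H θ.y θ k T]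
  simp_rw [π.sum_pulls H θ.y]
  simp

theorem sum_gap_play_eq [NeZero K] (θ : Problem K) (ω : π.Seed × (ℕ → Fin K → ℝ)) (T : ℕ) :
    ∑ t ∈ Finset.range T, θ.gap (π.play H y ω.1 ω.2 t) = ∑ k, θ.gap k * π.pulls H y k ω T := by
  unfold pulls
  simp_rw [Finset.mul_sum]
  rw [Finset.sum_comm]
  simp

theorem regret_eq [NeZero K] (θ : Problem K) (T : ℕ) :
    π.regret H θ T = ∑ k, θ.gap k * π.expectedPulls H θ k T := by
  have : ∀ ω : π.Seed × (ℕ → Fin K → ℝ), ∑ t ∈ Finset.range T,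
      (θ.bestMean - θ.mean (π.play H θ.y ω.1 ω.2 t)) = ∑ k, θ.gap k * π.pulls H θ.y k ω T :=
    fun ω => π.sum_gap_play_eq H θ.y θ ω T
  unfold regret
  simp_rw [this, expectedPulls_eq]
  rw [integral_finsetSum _ fun k _ => (π.integrable_pulls H θ.y θ k T).const_mul _]
  simp_rw [integral_const_mul]

/-- The decision at time `s` uses only earlier rows and the seed, hence is independent of the reward
drawn at `s`. This is the single-epoch form of Wald's identity. -/
theorem map_restrict_reward (θ : Problem K) (s : ℕ) (k : Fin K) :
    ((π.law θ).restrict {ω | π.play H y ω.1 ω.2 s = k}).map (fun ω => ω.2 s k) =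
      (π.law θ) {ω | π.play H y ω.1 ω.2 s = k} • (θ.ν k : Measure ℝ) := by
  classical
  ext B hB
  have hA := π.measurableSet_play_eq H y s k
  have hR := π.measurable_reward s k
  rw [Measure.map_apply hR hB, Measure.restrict_apply (hR hB), Measure.smul_apply, smul_eq_mul,
    Set.inter_comm, ← lintegral_indicator_one (hA.inter (hR hB)), ← lintegral_indicator_one hA]
  unfold law
  rw [lintegral_resample _ _ _ s (fun _ _ => rfl)
    (measurable_one.indicator (hA.inter (hR hB))),
    ← lintegral_mul_const _ (measurable_one.indicator hA)]
  refine lintegral_congr fun ω => ?_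
  have : ∀ x : Fin K → ℝ, ({ω : π.Seed × (ℕ → Fin K → ℝ) | π.play H y ω.1 ω.2 s = k} ∩
      (fun ω => ω.2 s k) ⁻¹' B).indicator (1 : π.Seed × (ℕ → Fin K → ℝ) → ENNReal)
        (ω.1, Function.update ω.2 s x) =
      {ω : π.Seed × (ℕ → Fin K → ℝ) | π.play H y ω.1 ω.2 s = k}.indicator 1 ω *
        B.indicator 1 (x k) := fun x => by
    simp only [Set.indicator, Set.mem_inter_iff, Set.mem_ofPred_eq, Set.mem_preimage,
      π.play_update_of_le H y _ _ le_rfl, Function.update_self, Pi.one_apply]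
    split_ifs <;> simp_all
  simp_rw [this]
  have hB1 : Measurable (B.indicator (1 : ℝ → ENNReal)) := measurable_one.indicator hB
  have hB2 : Measurable fun x : Fin K → ℝ => B.indicator (1 : ℝ → ENNReal) (x k) :=
    hB1.comp (measurable_pi_apply k)
  rw [lintegral_const_mul _ hB2, lintegral_coord θ.ν k hB1, lintegral_indicator_one hB]

theorem integrable_obs_and_integral (θ : Problem K) (s : ℕ) (k : Fin K) {g : ℝ → ℝ}
    (hg : Measurable g) (hint : Integrable g (θ.ν k : Measure ℝ)) :
    Integrable (fun ω => if π.play H y ω.1 ω.2 s = k then g (ω.2 s k) else 0) (π.law θ) ∧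
      ∫ ω, (if π.play H y ω.1 ω.2 s = k then g (ω.2 s k) else 0) ∂(π.law θ) =
        (∫ x, g x ∂(θ.ν k : Measure ℝ)) *
          ∫ ω, (if π.play H y ω.1 ω.2 s = k then (1 : ℝ) else 0) ∂(π.law θ) := by
  have hA := π.measurableSet_play_eq H y s k
  have hR := π.measurable_reward s k
  have hmap := π.map_restrict_reward H y θ s k
  have hind : ∀ h : π.Seed × (ℕ → Fin K → ℝ) → ℝ,
      (fun ω => if π.play H y ω.1 ω.2 s = k then h ω else 0) =
        {ω | π.play H y ω.1 ω.2 s = k}.indicator h := fun h => by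
    funext ω
    simp [Set.indicator]
  have hI : Integrable g (((π.law θ).restrict {ω | π.play H y ω.1 ω.2 s = k}).map
      (fun ω => ω.2 s k)) := by
    rw [hmap]
    exact hint.smul_measure (measure_ne_top _ _)
  constructor
  · rw [hind, integrable_indicator_iff hA]
    exact hI.comp_measurable hR
  · rw [hind, hind, integral_indicator hA, integral_indicator hA,
      ← integral_map hR.aemeasurable hg.aestronglyMeasurable, hmap, integral_smul_measure]
    simp [Measure.real, mul_comm]

theorem integrable_obsSum (θ : Problem K) (k : Fin K) {g : ℝ → ℝ}
    (hg : Measurable g) (hint : Integrable g (θ.ν k : Measure ℝ)) (T : ℕ) :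
    Integrable (fun ω => π.obsSum H y k g ω T) (π.law θ) :=
  integrable_finsetSum _ fun s _ => (π.integrable_obs_and_integral H y θ s k hg hint).1

/-- Wald's identity for the observed rewards of one arm. -/
theorem integral_obsSum (θ : Problem K) (k : Fin K) {g : ℝ → ℝ}
    (hg : Measurable g) (hint : Integrable g (θ.ν k : Measure ℝ)) (T : ℕ) :
    ∫ ω, π.obsSum H y k g ω T ∂(π.law θ) =
      (∫ x, g x ∂(θ.ν k : Measure ℝ)) * ∫ ω, π.pulls H y k ω T ∂(π.law θ) := by
  unfold obsSum pulls
  rw [integral_finsetSum _ fun s _ => (π.integrable_obs_and_integral H y θ s k hg hint).1,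
    integral_finsetSum _ fun s _ => (π.integrable_obs_and_integral H y θ s k
      measurable_const (integrable_const 1)).1, Finset.mul_sum]
  exact Finset.sum_congr rfl fun s _ => (π.integrable_obs_and_integral H y θ s k hg hint).2

/-- An event that is likely in `θ` cannot be too unlikely in an alternative that only changes the
law of arm `k`, unless arm `k` is pulled often. -/
theorem exp_neg_le_measureReal (θ θ' : Problem K) (k : Fin K) {g : ℝ → ℝ}
    (hg : Measurable g) (hint : Integrable g (θ.ν k : Measure ℝ))
    (hν : ∀ j, j ≠ k → θ.ν j = θ'.ν j)
    (hdom : (θ.ν k : Measure ℝ).withDensity (fun x => ENNReal.ofReal (Real.exp (-g x))) ≤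
      (θ'.ν k : Measure ℝ)) (T : ℕ) {E : Set (π.Seed × (ℕ → Fin K → ℝ))} (hE : MeasurableSet E)
    (hdep : ∀ u X X', (∀ t < T, X t (π.play H θ.y u X t) = X' t (π.play H θ.y u X t)) →
      ((u, X) ∈ E ↔ (u, X') ∈ E))
    (hhalf : 1 / 2 ≤ (π.law θ).real E) :
    1 / 2 * Real.exp (-(2 * ((∫ x, g x ∂(θ.ν k : Measure ℝ)) * π.expectedPulls H θ k T + 1))) ≤
      (π.law θ').real E := by
  classical
  set Z : π.Seed × (ℕ → Fin K → ℝ) → ℝ := fun ω => π.obsSum H θ.y k g ω T with hZ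
  have hZm : Measurable Z := π.measurable_obsSum H θ.y k hg T
  have hZi : Integrable Z (π.law θ) := π.integrable_obsSum H θ.y θ k hg hint T
  set Dn := (∫ x, g x ∂(θ.ν k : Measure ℝ)) * π.expectedPulls H θ k T with hDn
  have hZint : ∫ ω, Z ω ∂(π.law θ) = Dn := π.integral_obsSum H θ.y θ k hg hint T
  have hf : Measurable fun x => ENNReal.ofReal (Real.exp (-g x)) :=
    (Real.measurable_exp.comp hg.neg).ennreal_ofReal
  have hW : ∀ ω, π.obsWeight H θ.y k (fun x => ENNReal.ofReal (Real.exp (-g x))) ω T =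
      ENNReal.ofReal (Real.exp (-Z ω)) := fun ω => by
    rw [obsWeight_exp]
    congr 2
    simpa [hZ] using π.obsSum_affine H θ.y k g (-1) 0 ω T
  have hexpm : Measurable fun ω => Real.exp (-Z ω) := Real.measurable_exp.comp hZm.neg
  have hdomE := fun (A : Set (π.Seed × (ℕ → Fin K → ℝ))) (hA : MeasurableSet A)
      (hAdep : ∀ u X X', (∀ t < T, X t (π.play H θ.y u X t) = X' t (π.play H θ.y u X t)) →
      ((u, X) ∈ A ↔ (u, X') ∈ A)) =>
    π.lintegral_mul_obsWeight_le H θ.y θ θ' k hf hν hdom T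
      (G := A.indicator 1) (measurable_one.indicator hA) fun u X X' h => by
        simp only [Set.indicator, hAdep u X X' h, Pi.one_apply]
  have hbound : ∀ A, MeasurableSet A →
      (∀ u X X', (∀ t < T, X t (π.play H θ.y u X t) = X' t (π.play H θ.y u X t)) →
      ((u, X) ∈ A ↔ (u, X') ∈ A)) →
      ∫⁻ ω in A, ENNReal.ofReal (Real.exp (-Z ω)) ∂(π.law θ) ≤ π.law θ' A := by
    intro A hA hAdep
    have h := hdomE A hA hAdep
    rw [lintegral_indicator_one hA] at h
    refine le_trans (le_of_eq ?_) h
    rw [← lintegral_indicator hA]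
    refine lintegral_congr fun ω => ?_
    rw [hW]
    simp only [Set.indicator, Pi.one_apply]
    split_ifs <;> simp
  have hall := hbound Set.univ MeasurableSet.univ (by simp)
  rw [Measure.restrict_univ, measure_univ] at hall
  have hexpi : Integrable (fun ω => Real.exp (-Z ω)) (π.law θ) := by
    refine ⟨hexpm.aestronglyMeasurable, ?_⟩
    rw [hasFiniteIntegral_iff_ofReal (Filter.Eventually.of_forall fun ω => (Real.exp_pos _).le)]
    exact hall.trans_lt ENNReal.one_lt_top
  have htot : ∫ ω, Real.exp (-Z ω) ∂(π.law θ) ≤ 1 := by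
    rw [integral_eq_lintegral_of_nonneg_ae
      (Filter.Eventually.of_forall fun ω => (Real.exp_pos _).le) hexpm.aestronglyMeasurable]
    exact ENNReal.toReal_le_of_le_ofReal zero_le_one (by simpa using hall)
  have hEexp : ∫ ω in E, Real.exp (-Z ω) ∂(π.law θ) ≤ (π.law θ').real E := by
    rw [integral_eq_lintegral_of_nonneg_ae
      (Filter.Eventually.of_forall fun ω => (Real.exp_pos _).le) hexpm.aestronglyMeasurable]
    exact ENNReal.toReal_mono (measure_ne_top _ _) (hbound E hE hdep)
  refine le_trans ?_ hEexp
  -- The bound below uses the tangent line of the exponential: on `E`, `exp (-Z) = exp (-a) * exp (a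
  -- - Z)` and `exp (a - Z) ≥ 1 + a - Z`; off `E`, `-Z - exp (-Z)` is negative. After integration
  -- this value of `a` leaves exactly `(1 + a) / 2 - Dn - 1 = 1 / 2`. Replacing the probability of
  -- `E` by `1 / 2` needs `1 + a ≥ 0`, which `hD0` supplies.
  set a := 2 * (Dn + 1) with ha
  have hpt : ∀ ω, Real.exp (-a) * (E.indicator (fun _ => 1 + a) ω - Z ω - Real.exp (-Z ω)) ≤
      E.indicator (fun ω => Real.exp (-Z ω)) ω := by
    intro ω
    have hp := Real.exp_pos (-a)
    by_cases hω : ω ∈ E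
    · simp only [Set.indicator_of_mem hω]
      have h1 : Real.exp (-Z ω) = Real.exp (-a) * Real.exp (a - Z ω) := by
        rw [← Real.exp_add]; ring_nf
      have h2 := Real.add_one_le_exp (a - Z ω)
      have h3 := Real.exp_pos (-Z ω)
      calc _ ≤ Real.exp (-a) * Real.exp (a - Z ω) :=
            mul_le_mul_of_nonneg_left (by linarith) hp.le
        _ = _ := h1.symm
    · simp only [Set.indicator_of_notMem hω]
      have h2 := Real.add_one_le_exp (-Z ω)
      exact mul_nonpos_of_nonneg_of_nonpos hp.le (by linarith)
  have hconst : Integrable (E.indicator fun _ => 1 + a) (π.law θ) :=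
    (integrable_const _).indicator hE
  have hmono := integral_mono (((hconst.sub hZi).sub hexpi).const_mul (Real.exp (-a)))
    (hexpi.indicator hE) hpt
  rw [integral_indicator hE, integral_const_mul] at hmono
  refine le_trans ?_ hmono
  have hcalc : ∫ ω, ((E.indicator (fun _ => 1 + a) - Z) - fun ω => Real.exp (-Z ω)) ω ∂(π.law θ)
      = (π.law θ).real E * (1 + a) - Dn - ∫ ω, Real.exp (-Z ω) ∂(π.law θ) := by
    rw [integral_sub' (hconst.sub hZi) hexpi, integral_sub' hconst hZi, integral_indicator hE,
      hZint]
    simp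
  have hge : (1 : ℝ) / 2 ≤ (π.law θ).real E * (1 + a) - Dn -
      ∫ ω, Real.exp (-Z ω) ∂(π.law θ) := by
    have hD0 : -1 ≤ Dn := by
      have : ∫ ω, -Z ω ∂(π.law θ) ≤ ∫ ω, (Real.exp (-Z ω) - 1) ∂(π.law θ) :=
        integral_mono hZi.neg (hexpi.sub (integrable_const _)) fun ω => by
          have := Real.add_one_le_exp (-Z ω)
          simp only
          linarith
      rw [integral_neg, hZint, integral_sub hexpi (integrable_const _)] at this
      simp at this
      linarith
    nlinarith
  rw [mul_comm]
  refine mul_le_mul_of_nonneg_left ?_ (Real.exp_pos _).le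
  exact hge.trans hcalc.symm.le

/-- Markov's inequality for the supermartingale of weights `exp g`: a Chernoff bound at a random
sample size. -/
theorem measureReal_le_exp_neg (θ : Problem K) (k : Fin K) {g : ℝ → ℝ} (hg : Measurable g)
    (hg1 : ∫⁻ x, ENNReal.ofReal (Real.exp (g x)) ∂(θ.ν k : Measure ℝ) ≤ 1) (T : ℕ) (a : ℝ) :
    (π.law θ).real {ω | a ≤ π.obsSum H y k g ω T} ≤ Real.exp (-a) := by
  have hf : Measurable fun x => ENNReal.ofReal (Real.exp (g x)) :=
    (Real.measurable_exp.comp hg).ennreal_ofReal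
  have h1 := π.lintegral_obsWeight_le_one H y θ k hf hg1 T
  have h2 := mul_meas_ge_le_lintegral (μ := π.law θ) (π.measurable_obsWeight H y k hf T)
    (ENNReal.ofReal (Real.exp a))
  have h3 : {ω | ENNReal.ofReal (Real.exp a) ≤
      π.obsWeight H y k (fun x => ENNReal.ofReal (Real.exp (g x))) ω T} =
      {ω | a ≤ π.obsSum H y k g ω T} := by
    ext ω
    simp only [obsWeight_exp, Set.mem_ofPred_eq]
    rw [ENNReal.ofReal_le_ofReal_iff (Real.exp_pos _).le, Real.exp_le_exp]
  rw [h3] at h2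
  have h4 := ENNReal.toReal_mono ENNReal.one_ne_top (h2.trans h1)
  rw [ENNReal.toReal_mul, ENNReal.toReal_ofReal (Real.exp_pos _).le, ENNReal.toReal_one] at h4
  rw [Real.exp_neg, ← one_div, le_div_iff₀ (Real.exp_pos a), mul_comm]
  exact h4

/-- When the sum is nonnegative the weight is at least `1`, while each pull of the arm shrinks the
expected weight by the factor `q`. The pulls made in such epochs therefore total at most a geometric
series, uniformly in `T`. -/
theorem sum_measureReal_le (θ : Problem K) (k : Fin K) {g : ℝ → ℝ} (hg : Measurable g)
    {q : ℝ} (hq0 : 0 ≤ q) (hq1 : q < 1)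
    (hgq : ∫⁻ x, ENNReal.ofReal (Real.exp (g x)) ∂(θ.ν k : Measure ℝ) ≤ ENNReal.ofReal q)
    (T : ℕ) :
    ∑ t ∈ Finset.range T,
      (π.law θ).real {ω | π.play H y ω.1 ω.2 t = k ∧ 0 ≤ π.obsSum H y k g ω t} ≤
        1 / (1 - q) := by
  have hf : Measurable fun x => ENNReal.ofReal (Real.exp (g x)) :=
    (Real.measurable_exp.comp hg).ennreal_ofReal
  have h1 := le_of_add_le_left (π.sum_obsWeight_le H y θ k hf
    (by simpa using hq1.le) hgq T)
  have h2 : ∀ t, (π.law θ) {ω | π.play H y ω.1 ω.2 t = k ∧ 0 ≤ π.obsSum H y k g ω t} ≤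
      ∫⁻ ω, (if π.play H y ω.1 ω.2 t = k then
        π.obsWeight H y k (fun x => ENNReal.ofReal (Real.exp (g x))) ω t else 0) ∂(π.law θ) := by
    intro t
    have hm : MeasurableSet {ω : π.Seed × (ℕ → Fin K → ℝ) |
        π.play H y ω.1 ω.2 t = k ∧ 0 ≤ π.obsSum H y k g ω t} :=
      (π.measurableSet_play_eq H y t k).inter
        (measurableSet_le measurable_const (π.measurable_obsSum H y k hg t))
    rw [← lintegral_indicator_one hm]
    refine lintegral_mono fun ω => ?_
    simp only [Set.indicator, Set.mem_ofPred_eq, Pi.one_apply, obsWeight_exp]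
    split_ifs with h h' h'
    · simpa using h.2
    · exact absurd h.1 h'
    · exact zero_le
    · exact le_rfl
  have h3 := (mul_le_mul_right (Finset.sum_le_sum fun t (_ : t ∈ Finset.range T) => h2 t)
    (1 - ENNReal.ofReal q)).trans h1
  have h4 := ENNReal.toReal_mono ENNReal.one_ne_top h3
  rw [ENNReal.toReal_mul, ENNReal.toReal_sum fun _ _ => measure_ne_top _ _,
    ← ENNReal.ofReal_one, ← ENNReal.ofReal_sub _ hq0, ENNReal.toReal_ofReal (by linarith),
    ENNReal.toReal_ofReal zero_le_one] at h4
  rw [le_div_iff₀ (by linarith), mul_comm]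
  exact h4

/-- Only about `u` pulls of an arm can occur while it has been pulled less than `u` times. -/
theorem sum_early_pulls_le (k : Fin K) (ω : π.Seed × (ℕ → Fin K → ℝ)) {u : ℝ} (hu : 0 ≤ u)
    (T : ℕ) :
    ∑ t ∈ Finset.range T,
      (if π.play H y ω.1 ω.2 t = k ∧ π.pulls H y k ω t < u then (1 : ℝ) else 0) ≤ u + 1 := by
  -- The bound by the number of pulls is what makes the induction close: a pull counted at time `T`
  -- has fewer than `u` predecessors.
  suffices h : ∑ t ∈ Finset.range T,
      (if π.play H y ω.1 ω.2 t = k ∧ π.pulls H y k ω t < u then (1 : ℝ) else 0) ≤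
        min (π.pulls H y k ω T) (u + 1) from h.trans (min_le_right _ _)
  induction T with
  | zero => simpa [pulls] using by linarith
  | succ T ih =>
    have hs : π.pulls H y k ω (T + 1) =
        π.pulls H y k ω T + if π.play H y ω.1 ω.2 T = k then 1 else 0 := by
      simp only [pulls, Finset.sum_range_succ]
    rw [Finset.sum_range_succ, hs]
    rw [le_min_iff] at ih ⊢
    split_ifs with h1 h2 h2
    · constructor <;> linarith [h1.2]
    · exact absurd h1.1 h2
    · constructor <;> linarith
    · constructor <;> linarith

end Policy

/-! ### Sub-Gaussian concentration and peeling -/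

/-- Supplies the weights: `d = 0` gives mass at most `1` for Chernoff bounds, and `d > 0` gives a
factor below `1` for the geometric sum. -/
theorem lintegral_exp_le_of_subgaussian {ν : Measure ℝ} {m : ℝ} {σ : ℝ≥0}
    (h : HasSubgaussianMGF (fun x => x - m) (σ ^ 2) ν) (l d : ℝ) :
    ∫⁻ x, ENNReal.ofReal (Real.exp (l * (x - m) + -(l ^ 2 * σ ^ 2 / 2 + d))) ∂ν ≤
      ENNReal.ofReal (Real.exp (-d)) := by
  have hi := h.integrable_exp_mul l
  have hm := h.mgf_le l
  simp_rw [Real.exp_add (l * _)]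
  rw [← ofReal_integral_eq_lintegral_ofReal (hi.mul_const _)
    (Filter.Eventually.of_forall fun x => by positivity), integral_mul_const]
  refine ENNReal.ofReal_le_ofReal ?_
  have he : Real.exp (-d) = Real.exp (((σ ^ 2 : ℝ≥0) : ℝ) * l ^ 2 / 2) *
      Real.exp (-(l ^ 2 * σ ^ 2 / 2 + d)) := by
    rw [← Real.exp_add]
    congr 1
    push_cast
    ring
  rw [he]
  exact mul_le_mul_of_nonneg_right hm (Real.exp_pos _).le

/-- The event that the upper confidence bound of arm `k` fails at time `t`. -/
def Policy.underestimated {K : ℕ} (π : Policy.{u} K) (H : ℕ → Fin K → ℕ) (θ : Problem K)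
    (σ : ℝ≥0) (c : ℝ) (k : Fin K) (t : ℕ) : Set (π.Seed × (ℕ → Fin K → ℝ)) :=
  {ω | 1 ≤ π.pulls H θ.y k ω t ∧ π.obsSum H θ.y k (fun x => x - θ.mean k) ω t <
    -√(c * (σ : ℝ) ^ 2 * Real.log (t + 1) * π.pulls H θ.y k ω t)}

/-- The ratio of the peeling scales. -/
noncomputable def peelRatio (c : ℝ) : ℝ := 1 + √((1 - 2 / c) / 2)

theorem one_lt_peelRatio {c : ℝ} (hc : 2 < c) : 1 < peelRatio c := by
  have : 2 / c < 1 := (div_lt_one (by linarith)).mpr hc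
  have : 0 < √((1 - 2 / c) / 2) := Real.sqrt_pos.mpr (by linarith)
  unfold peelRatio
  linarith

/-- Since `c * (x - x ^ 2 / 2) = c / 2 - c * (x - 1) ^ 2 / 2`, the loss from a mismatched scale is
at most `(c - 2) / 4`; `peelRatio` is chosen for this. The remaining exponent `c / 4 + 1 / 2`
exceeds `1` exactly when `2 < c`. -/
theorem peel_exponent {c : ℝ} (hc : 2 < c) {x : ℝ} (h1 : 1 ≤ x) (h2 : x ≤ peelRatio c) :
    c / 4 + 1 / 2 ≤ c * (x - x ^ 2 / 2) := by
  have h0 : 2 / c < 1 := (div_lt_one (by linarith)).mpr hc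
  have hsq : √((1 - 2 / c) / 2) ^ 2 = (1 - 2 / c) / 2 := Real.sq_sqrt (by linarith)
  have h3 : (x - 1) ^ 2 ≤ (1 - 2 / c) / 2 := by
    rw [← hsq]
    unfold peelRatio at h2
    exact pow_le_pow_left₀ (by linarith) (by linarith) 2
  have h4 : c * (x - 1) ^ 2 ≤ c * ((1 - 2 / c) / 2) := mul_le_mul_of_nonneg_left h3 (by linarith)
  have h5 : c * ((1 - 2 / c) / 2) = (c - 2) / 2 := by
    field_simp
  nlinarith

/-- The optimal tilt depends on the random pull count `N`. Locating `√N` between consecutive powers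
of the peeling ratio leaves only logarithmically many deterministic tilts, hence a union bound with
a logarithmic factor instead of `t`. -/
theorem Policy.measureReal_underestimated_le {K : ℕ} (π : Policy.{u} K) (H : ℕ → Fin K → ℕ)
    (θ : Problem K) {σ : ℝ≥0} (hσ : 0 < σ) {c : ℝ} (hc : 2 < c) (k : Fin K)
    (hsub : HasSubgaussianMGF (fun x => x - θ.mean k) (σ ^ 2) (θ.ν k : Measure ℝ)) (t : ℕ) :
    (π.law θ).real (π.underestimated H θ σ c k t) ≤
      (Real.log (t + 1) / Real.log (peelRatio c) + 1) *
        Real.exp (-((c / 4 + 1 / 2) * Real.log (t + 1))) := by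
  set β := peelRatio c with hβ
  have hβ1 : 1 < β := one_lt_peelRatio hc
  have hlβ : 0 < Real.log β := Real.log_pos hβ1
  set L := Real.log ((t : ℝ) + 1) with hL
  have hL0 : 0 ≤ L := Real.log_nonneg (by linarith [(Nat.cast_nonneg t : (0 : ℝ) ≤ t)])
  have hσ' : (0 : ℝ) < σ := hσ
  -- The Chernoff tilt that is optimal when `√N = β ^ j`, negative because the lower tail is at
  -- stake.
  let lam : ℕ → ℝ := fun j => -(√(c * L) / (σ * β ^ j))
  let g : ℕ → ℝ → ℝ := fun j x => lam j * (x - θ.mean k) + -((lam j) ^ 2 * σ ^ 2 / 2 + 0)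
  set J := ⌊L / Real.log β⌋₊ + 1 with hJ
  have hcover : π.underestimated H θ σ c k t ⊆ ⋃ j ∈ Finset.range J,
      {ω | (c / 4 + 1 / 2) * L ≤ π.obsSum H θ.y k (g j) ω t} := by
    rintro ω ⟨hN1, hS⟩
    have hNt := π.pulls_le H θ.y k ω t
    set N := π.pulls H θ.y k ω t with hN
    have hN0 : 0 < N := by linarith
    obtain ⟨j, hj1, hj2⟩ := exists_nat_pow_near (Real.one_le_sqrt.mpr hN1) hβ1
    have hβj : 0 < β ^ j := by positivity
    refine Set.mem_biUnion (x := j) ?_ ?_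
    · rw [Finset.mem_coe, Finset.mem_range, hJ, Nat.lt_succ_iff]
      refine Nat.le_floor ?_
      rw [le_div_iff₀ hlβ, ← Real.log_pow, hL]
      refine Real.log_le_log hβj (hj1.trans ?_)
      rw [Real.sqrt_le_left (by linarith)]
      nlinarith
    · simp only [Set.mem_ofPred_eq, g]
      rw [π.obsSum_affine H θ.y k (fun x => x - θ.mean k), ← hN]
      set S := π.obsSum H θ.y k (fun x => x - θ.mean k) ω t
      set x := √N / β ^ j with hx
      have hx1 : 1 ≤ x := by rw [hx, le_div_iff₀ hβj]; linarith
      have hx2 : x ≤ β := by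
        rw [hx, div_le_iff₀ hβj, mul_comm, ← pow_succ]
        exact hj2.le
      have hpe := mul_le_mul_of_nonneg_right (peel_exponent hc hx1 hx2) hL0
      refine hpe.trans ?_
      have hsq : √(c * (σ : ℝ) ^ 2 * L * N) = σ * √(c * L) * √N := by
        rw [show c * (σ : ℝ) ^ 2 * L * N = σ ^ 2 * ((c * L) * N) by ring,
          Real.sqrt_mul (by positivity), Real.sqrt_sq hσ'.le, Real.sqrt_mul (by positivity)]
        ring
      rw [hsq] at hS
      have hcL : √(c * L) ^ 2 = c * L := Real.sq_sqrt (by positivity)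
      have hNs : √N ^ 2 = N := Real.sq_sqrt hN0.le
      have hA : 0 ≤ √(c * L) / (σ * β ^ j) := by positivity
      have h1 : √(c * L) / (σ * β ^ j) * (σ * √(c * L) * √N) ≤ lam j * S := by
        simp only [lam]
        nlinarith [mul_le_mul_of_nonneg_left hS.le hA]
      have h2 : √(c * L) / (σ * β ^ j) * (σ * √(c * L) * √N) = c * L * x := by
        rw [hx]
        field_simp
        rw [hcL]
      have h3 : (lam j) ^ 2 * σ ^ 2 / 2 * N = c * L * x ^ 2 / 2 := by
        simp only [lam, hx, neg_sq, div_pow, mul_pow, hcL, hNs]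
        field_simp
      nlinarith
  have hgm : ∀ j, Measurable (g j) := fun j => by
    simp only [g]
    fun_prop
  calc (π.law θ).real (π.underestimated H θ σ c k t)
      ≤ (π.law θ).real (⋃ j ∈ Finset.range J,
        {ω | (c / 4 + 1 / 2) * L ≤ π.obsSum H θ.y k (g j) ω t}) :=
        measureReal_mono hcover (measure_ne_top _ _)
    _ ≤ ∑ j ∈ Finset.range J, (π.law θ).real
        {ω | (c / 4 + 1 / 2) * L ≤ π.obsSum H θ.y k (g j) ω t} :=
        measureReal_biUnion_finset_le _ _
    _ ≤ ∑ _j ∈ Finset.range J, Real.exp (-((c / 4 + 1 / 2) * L)) := by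
        refine Finset.sum_le_sum fun j _ => π.measureReal_le_exp_neg H θ.y θ k (hgm j) ?_ t _
        simpa [g] using lintegral_exp_le_of_subgaussian hsub (lam j) 0
    _ ≤ _ := by
        rw [Finset.sum_const, Finset.card_range, nsmul_eq_mul]
        refine mul_le_mul_of_nonneg_right ?_ (Real.exp_pos _).le
        rw [hJ]
        push_cast
        have := Nat.floor_le (show 0 ≤ L / Real.log β by positivity)
        linarith

theorem exists_peel_sum_bound {c : ℝ} (hc : 2 < c) : ∃ F : ℝ, 0 < F ∧ ∀ T : ℕ,
    ∑ t ∈ Finset.range T, (Real.log (t + 1) / Real.log (peelRatio c) + 1) *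
      Real.exp (-((c / 4 + 1 / 2) * Real.log (t + 1))) ≤ F := by
  set b := Real.log (peelRatio c) with hb
  have hb0 : 0 < b := Real.log_pos (one_lt_peelRatio hc)
  set p := c / 4 + 1 / 2 with hp
  have hp1 : 1 < p := by rw [hp]; linarith
  -- Half of the excess of `p` over `1` pays for the logarithm; the other half keeps the series
  -- convergent.
  set d := (p - 1) / 2 with hd
  have hd0 : 0 < d := by rw [hd]; linarith
  have hsum : Summable fun t : ℕ => (1 / (d * b) + 1) * ((t : ℝ) + 1) ^ (-(p - d)) := by
    refine Summable.mul_left _ ?_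
    have := (summable_nat_add_iff 1).mpr
      (Real.summable_nat_rpow (p := -(p - d)) |>.mpr (by rw [hd]; linarith))
    simpa using this
  have hterm : ∀ t : ℕ, (Real.log (t + 1) / b + 1) * Real.exp (-(p * Real.log (t + 1))) ≤
      (1 / (d * b) + 1) * ((t : ℝ) + 1) ^ (-(p - d)) := by
    intro t
    have ht : (1 : ℝ) ≤ (t : ℝ) + 1 := by linarith [(Nat.cast_nonneg t : (0 : ℝ) ≤ t)]
    have ht0 : (0 : ℝ) < (t : ℝ) + 1 := by linarith
    have he : Real.exp (-(p * Real.log (t + 1))) = ((t : ℝ) + 1) ^ (-p) := by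
      rw [Real.rpow_def_of_pos ht0]
      ring_nf
    have hlog := Real.log_le_rpow_div ht0.le hd0
    have hone : (1 : ℝ) ≤ ((t : ℝ) + 1) ^ d := Real.one_le_rpow ht hd0.le
    have h1 : Real.log (t + 1) / b + 1 ≤ (1 / (d * b) + 1) * ((t : ℝ) + 1) ^ d := by
      have : Real.log (t + 1) / b ≤ ((t : ℝ) + 1) ^ d / d / b :=
        div_le_div_of_nonneg_right hlog hb0.le
      have h2 : ((t : ℝ) + 1) ^ d / d / b = 1 / (d * b) * ((t : ℝ) + 1) ^ d := by field_simp
      linarith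
    have h3 : ((t : ℝ) + 1) ^ (-(p - d)) = ((t : ℝ) + 1) ^ d * ((t : ℝ) + 1) ^ (-p) := by
      rw [← Real.rpow_add ht0]
      ring_nf
    rw [he, h3, ← mul_assoc]
    exact mul_le_mul_of_nonneg_right h1 (Real.rpow_nonneg ht0.le _)
  refine ⟨∑' t : ℕ, (1 / (d * b) + 1) * ((t : ℝ) + 1) ^ (-(p - d)) + 1, ?_, fun T => ?_⟩
  · have : 0 ≤ ∑' t : ℕ, (1 / (d * b) + 1) * ((t : ℝ) + 1) ^ (-(p - d)) :=
      tsum_nonneg fun t => by positivity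
    linarith
  · have h1 := Finset.sum_le_sum fun t (_ : t ∈ Finset.range T) => hterm t
    have h2 := hsum.sum_le_tsum (Finset.range T) fun t _ => by positivity
    linarith

/-! ### Elementary facts about instances and runs of UCB1+ -/

namespace Problem

variable {K : ℕ} [NeZero K] (θ : Problem K)

theorem mean_le_bestMean (k : Fin K) : θ.mean k ≤ θ.bestMean :=
  ((firstArgmax_eq_iff θ.mean θ.bestArm).mp rfl).1 k

theorem gap_nonneg (k : Fin K) : 0 ≤ θ.gap k := sub_nonneg.mpr (θ.mean_le_bestMean k)

theorem gap_bestArm : θ.gap θ.bestArm = 0 := sub_self _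

theorem mem_contenders {ahi : ℝ} {k : Fin K} :
    k ∈ θ.contenders ahi ↔ k ≠ θ.bestArm ∧ θ.bestMean ≤ ahi * θ.y k := by
  classical
  simp [contenders]

end Problem

theorem auxMean_zero {K : ℕ} {H : ℕ → Fin K → ℕ} (hH : ∀ k, H 0 k = 1) (y : Fin K → ℝ)
    (k : Fin K) : auxMean H y 0 k = y k := by
  simp [auxMean, hH]

theorem obsSum_id_eq {K : ℕ} {H : ℕ → Fin K → ℕ} {θ : Problem K} (π : Policy.{u} K)
    (k : Fin K) (ω : π.Seed × (ℕ → Fin K → ℝ)) (t : ℕ) :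
    π.obsSum H θ.y k (fun x => x) ω t =
      π.obsSum H θ.y k (fun x => x - θ.mean k) ω t + θ.mean k * π.pulls H θ.y k ω t := by
  have := π.obsSum_affine H θ.y k (fun x => x - θ.mean k) 1 (θ.mean k) ω t
  simpa using this

theorem measurableSet_underestimated {K : ℕ} {H : ℕ → Fin K → ℕ} {θ : Problem K} {σ : ℝ≥0}
    {c : ℝ} (π : Policy.{u} K) (k : Fin K) (t : ℕ) :
    MeasurableSet (π.underestimated H θ σ c k t) := by
  have h1 := π.measurable_pulls H θ.y k t
  have h2 := π.measurable_obsSum H θ.y k (g := fun x => x - θ.mean k)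
    (measurable_id.sub_const _) t
  exact (measurableSet_le measurable_const h1).inter
    (measurableSet_lt h2 (Real.continuous_sqrt.measurable.comp (h1.const_mul _)).neg)

section UCB

variable {K : ℕ} [NeZero K] (σ : ℝ≥0) (ahi c : ℝ) (H : ℕ → Fin K → ℕ) (y : Fin K → ℝ)

theorem ucb1Plus_play_of_lt (u : (ucb1Plus.{u} K σ ahi c).Seed) (X : ℕ → Fin K → ℝ) {t : ℕ}
    (ht : t < K) : (ucb1Plus.{u} K σ ahi c).play H y u X t = ⟨t, ht⟩ := by
  rw [Policy.play]
  simp [ucb1Plus, ht]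

/-- The capped upper confidence bound of arm `k` at time `t` along a run of UCB1+. -/
noncomputable def runUCB (ω : (ucb1Plus.{u} K σ ahi c).Seed × (ℕ → Fin K → ℝ)) (t : ℕ)
    (k : Fin K) : ℝ :=
  min ((ucb1Plus.{u} K σ ahi c).obsSum H y k (fun x => x) ω t /
      max 1 ((ucb1Plus.{u} K σ ahi c).pulls H y k ω t) +
    √(c * (σ : ℝ) ^ 2 * Real.log (t + 1) / (ucb1Plus.{u} K σ ahi c).pulls H y k ω t))
    (ahi * y k)

theorem ucb1Plus_play_of_le (hH : ∀ k, H 0 k = 1)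
    (ω : (ucb1Plus.{u} K σ ahi c).Seed × (ℕ → Fin K → ℝ)) {t : ℕ} (ht : K ≤ t) :
    (ucb1Plus.{u} K σ ahi c).play H y ω.1 ω.2 t = firstArgmax (runUCB σ ahi c H y ω t) := by
  rw [Policy.play]
  have hnt : ¬ t < K := not_lt.mpr ht
  have hact : ∀ hist aux cnt, (ucb1Plus.{u} K σ ahi c).act t ω.1 hist aux cnt =
      firstArgmax fun k => cappedUCB σ ahi c t hist k (aux 0 k) := fun hist aux cnt => by
    simp [ucb1Plus, hnt]
  rw [hact]
  congr 1
  funext k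
  have h0 : auxMean H y ((0 : Fin (t + 1)) : ℕ) k = y k := by
    simpa using auxMean_zero hH y k
  have hp : ∀ hist : Fin t → Fin K × ℝ,
      (hist = fun s : Fin t => ((ucb1Plus.{u} K σ ahi c).play H y ω.1 ω.2 s,
        ω.2 s ((ucb1Plus.{u} K σ ahi c).play H y ω.1 ω.2 s))) →
      pullCount hist k = (ucb1Plus.{u} K σ ahi c).pulls H y k ω t := fun hist h => by
    rw [h]
    exact Fin.sum_univ_eq_sum_range (fun s : ℕ =>
      if (ucb1Plus.{u} K σ ahi c).play H y ω.1 ω.2 s = k then (1 : ℝ) else 0) t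
  have hr : ∀ hist : Fin t → Fin K × ℝ,
      (hist = fun s : Fin t => ((ucb1Plus.{u} K σ ahi c).play H y ω.1 ω.2 s,
        ω.2 s ((ucb1Plus.{u} K σ ahi c).play H y ω.1 ω.2 s))) →
      (∑ s, if (hist s).1 = k then (hist s).2 else 0) =
        (ucb1Plus.{u} K σ ahi c).obsSum H y k (fun x => x) ω t := fun hist h => by
    rw [h]
    refine Eq.trans ?_ (Fin.sum_univ_eq_sum_range (fun s : ℕ =>
      if (ucb1Plus.{u} K σ ahi c).play H y ω.1 ω.2 s = k then ω.2 s k else 0) t)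
    refine Finset.sum_congr rfl fun s _ => ?_
    by_cases hs : (ucb1Plus.{u} K σ ahi c).play H y ω.1 ω.2 s = k
    · simp [hs]
    · simp [hs]
  unfold cappedUCB empMean runUCB
  rw [hp _ rfl, hr _ rfl, h0]

theorem one_le_pulls_ucb1Plus (k : Fin K)
    (ω : (ucb1Plus.{u} K σ ahi c).Seed × (ℕ → Fin K → ℝ)) {t : ℕ} (ht : K ≤ t) :
    1 ≤ (ucb1Plus.{u} K σ ahi c).pulls H y k ω t := by
  have hk : (k : ℕ) ∈ Finset.range t := Finset.mem_range.mpr (k.2.trans_le ht)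
  refine le_trans ?_ (Finset.single_le_sum (fun s _ => ?_) hk)
  · rw [ucb1Plus_play_of_lt σ ahi c H y ω.1 ω.2 k.2]
    simp
  · split_ifs <;> simp

end UCB

/-! ### Analysis of UCB1+ -/

section Analysis

variable {K : ℕ} [NeZero K] {σ : ℝ≥0} {alo ahi Δ B c : ℝ} {H : ℕ → Fin K → ℕ} {θ : Problem K}

/-- An optimistic cap never falls below the mean. -/
theorem mean_le_cap (hθ : θ ∈ problemClass K σ alo ahi Δ B) (k : Fin K) :
    θ.mean k ≤ ahi * θ.y k := by
  obtain ⟨-, hy, ha, -, -⟩ := hθ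
  obtain ⟨a, ha, hak⟩ := ha k
  rw [← hak]
  exact mul_le_mul_of_nonneg_right ha.2 (hy k)

theorem mean_le_runUCB (hθ : θ ∈ problemClass K σ alo ahi Δ B)
    (k : Fin K) (ω : (ucb1Plus.{u} K σ ahi c).Seed × (ℕ → Fin K → ℝ)) {t : ℕ} (ht : K ≤ t)
    (hω : ω ∉ (ucb1Plus.{u} K σ ahi c).underestimated H θ σ c k t) :
    θ.mean k ≤ runUCB σ ahi c H θ.y ω t k := by
  refine le_min ?_ (mean_le_cap hθ k)
  have hN1 := one_le_pulls_ucb1Plus σ ahi c H θ.y k ω ht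
  rw [Policy.underestimated, Set.mem_ofPred_eq, not_and, not_lt] at hω
  have hS := hω hN1
  -- From time `K` on every arm has been pulled, so the guard `max 1` in the empirical mean is
  -- inactive.
  rw [obsSum_id_eq, max_eq_right hN1]
  set N := (ucb1Plus.{u} K σ ahi c).pulls H θ.y k ω t
  set S := (ucb1Plus.{u} K σ ahi c).obsSum H θ.y k (fun x => x - θ.mean k) ω t
  have hN0 : 0 < N := by linarith
  set A := c * (σ : ℝ) ^ 2 * Real.log (t + 1)
  have hsq : √(A / N) = √(A * N) / N := by
    rw [show A / N = A * N / N ^ 2 by field_simp, Real.sqrt_div' _ (sq_nonneg N),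
      Real.sqrt_sq hN0.le]
  have h1 : (S + θ.mean k * N) / N = S / N + θ.mean k := by field_simp
  rw [hsq, h1]
  have h2 : 0 ≤ (S + √(A * N)) / N := div_nonneg (by linarith) hN0.le
  rw [add_div] at h2
  linarith

/-- A suboptimal pull while the best arm is not underestimated. -/
theorem contender_of_play (hσ : 0 < σ) (hc : 0 < c) (hH : ∀ k, H 0 k = 1)
    (hθ : θ ∈ problemClass K σ alo ahi Δ B) {k : Fin K} (hk : k ≠ θ.bestArm)
    (ω : (ucb1Plus.{u} K σ ahi c).Seed × (ℕ → Fin K → ℝ)) {t T : ℕ} (ht : K ≤ t) (htT : t < T)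
    (hω : ω ∉ (ucb1Plus.{u} K σ ahi c).underestimated H θ σ c θ.bestArm t)
    (hplay : (ucb1Plus.{u} K σ ahi c).play H θ.y ω.1 ω.2 t = k) :
    k ∈ θ.contenders ahi ∧
      ((ucb1Plus.{u} K σ ahi c).pulls H θ.y k ω t < 4 * c * σ ^ 2 * Real.log T / θ.gap k ^ 2 ∨
        0 ≤ (ucb1Plus.{u} K σ ahi c).obsSum H θ.y k (fun x => θ.gap k / (2 * σ ^ 2) *
          (x - θ.mean k) + -((θ.gap k / (2 * σ ^ 2)) ^ 2 * σ ^ 2 / 2 +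
            θ.gap k ^ 2 / (8 * σ ^ 2))) ω t) := by
  have hbest : θ.bestMean ≤ runUCB σ ahi c H θ.y ω t θ.bestArm :=
    mean_le_runUCB hθ θ.bestArm ω ht hω
  rw [ucb1Plus_play_of_le σ ahi c H θ.y hH ω ht, firstArgmax_eq_iff] at hplay
  have hU := hbest.trans (hplay.1 θ.bestArm)
  refine ⟨θ.mem_contenders.mpr ⟨hk, hU.trans (min_le_right _ _)⟩, ?_⟩
  by_contra! hcon
  obtain ⟨hN, hS⟩ := hcon
  have hgap : 0 < θ.gap k := (hθ.2.2.2.1 k hk).1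
  have hσ' : (0 : ℝ) < σ := hσ
  rw [(ucb1Plus.{u} K σ ahi c).obsSum_affine H θ.y k (fun x => x - θ.mean k)] at hS
  have hN1 := one_le_pulls_ucb1Plus σ ahi c H θ.y k ω ht
  have hU' := hU.trans (min_le_left _ _)
  rw [obsSum_id_eq, max_eq_right hN1] at hU'
  set N := (ucb1Plus.{u} K σ ahi c).pulls H θ.y k ω t
  set S := (ucb1Plus.{u} K σ ahi c).obsSum H θ.y k (fun x => x - θ.mean k) ω t
  set g := θ.gap k with hg
  have hN0 : 0 < N := by linarith
  have hlog : Real.log ((t : ℝ) + 1) ≤ Real.log T := by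
    refine Real.log_le_log (by positivity) ?_
    exact_mod_cast htT
  -- The threshold on `N` is the one that brings the exploration bonus down to half the gap; the
  -- other half must then come from overestimation.
  have hsq : √(c * (σ : ℝ) ^ 2 * Real.log (t + 1) / N) ≤ g / 2 := by
    rw [Real.sqrt_le_left (by positivity), div_le_iff₀ hN0]
    rw [div_le_iff₀ (by positivity)] at hN
    have : c * (σ : ℝ) ^ 2 * Real.log (t + 1) ≤ c * (σ : ℝ) ^ 2 * Real.log T :=
      mul_le_mul_of_nonneg_left hlog (by positivity)
    nlinarith
  have h1 : (S + θ.mean k * N) / N = S / N + θ.mean k := by field_simp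
  have hbm : θ.bestMean = θ.mean k + g := by rw [hg, Problem.gap]; ring
  rw [h1, hbm] at hU'
  have h2 : g / 2 ≤ S / N := by linarith
  rw [le_div_iff₀ hN0] at h2
  have h3 : g / (2 * σ ^ 2) * (g / 2 * N) ≤ g / (2 * (σ : ℝ) ^ 2) * S :=
    mul_le_mul_of_nonneg_left h2 (by positivity)
  -- The tilt `g / (2 * σ ^ 2)` is optimal for a deviation of `g / 2`: half of the exponent `g ^ 2 /
  -- (4 * σ ^ 2)` per pull pays for the moment generating function, and half remains as decay.
  have h4 : g / (2 * (σ : ℝ) ^ 2) * (g / 2 * N) +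
      -((g / (2 * (σ : ℝ) ^ 2)) ^ 2 * σ ^ 2 / 2 + g ^ 2 / (8 * σ ^ 2)) * N = 0 := by
    field_simp
    ring
  linarith

/-- Each pull is charged to the initial round, to a failure for the best arm, to the early pulls, or
to an overestimate; the last two occur for contenders only. Failures stay intersected with the event
that `k` is played, so that summing over arms counts each failure once. -/
theorem expectedPulls_ucb1Plus_le (hσ : 0 < σ) (hc : 0 < c) (hH : ∀ k, H 0 k = 1)
    (hθ : θ ∈ problemClass K σ alo ahi Δ B) {k : Fin K} (hk : k ≠ θ.bestArm) {T : ℕ}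
    (hT : 1 ≤ T) :
    (ucb1Plus.{u} K σ ahi c).expectedPulls H θ k T ≤ 1 +
      ∑ t ∈ Finset.range T, ((ucb1Plus.{u} K σ ahi c).law θ).real
        ((ucb1Plus.{u} K σ ahi c).underestimated H θ σ c θ.bestArm t ∩
          {ω | (ucb1Plus.{u} K σ ahi c).play H θ.y ω.1 ω.2 t = k}) +
      if k ∈ θ.contenders ahi then
        4 * c * σ ^ 2 * Real.log T / θ.gap k ^ 2 + 2 + 8 * σ ^ 2 / θ.gap k ^ 2 else 0 := by
  classical
  set π := ucb1Plus.{u} K σ ahi c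
  have hgap : 0 < θ.gap k := (hθ.2.2.2.1 k hk).1
  have hσ' : (0 : ℝ) < σ := hσ
  set g := θ.gap k with hg
  set w := 4 * c * σ ^ 2 * Real.log T / g ^ 2 with hw
  have hw0 : 0 ≤ w := by
    have := Real.log_nonneg (show (1 : ℝ) ≤ T by exact_mod_cast hT)
    positivity
  set d := g ^ 2 / (8 * (σ : ℝ) ^ 2) with hd
  have hd0 : 0 < d := by positivity
  set f : ℝ → ℝ := fun x => g / (2 * σ ^ 2) * (x - θ.mean k) +
    -((g / (2 * σ ^ 2)) ^ 2 * σ ^ 2 / 2 + d) with hf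
  have hfm : Measurable f := by rw [hf]; fun_prop
  set Fail : ℕ → Set (π.Seed × (ℕ → Fin K → ℝ)) := fun t =>
    π.underestimated H θ σ c θ.bestArm t ∩ {ω | π.play H θ.y ω.1 ω.2 t = k} with hFail
  set Over : ℕ → Set (π.Seed × (ℕ → Fin K → ℝ)) := fun t =>
    {ω | π.play H θ.y ω.1 ω.2 t = k ∧ 0 ≤ π.obsSum H θ.y k f ω t} with hOver
  have hFm : ∀ t, MeasurableSet (Fail t) := fun t =>
    (measurableSet_underestimated π θ.bestArm t).inter (π.measurableSet_play_eq H θ.y t k)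
  have hOm : ∀ t, MeasurableSet (Over t) := fun t =>
    (π.measurableSet_play_eq H θ.y t k).inter
      (measurableSet_le measurable_const (π.measurable_obsSum H θ.y k hfm t))
  set χ : ℝ := if k ∈ θ.contenders ahi then 1 else 0 with hχ
  have hχ0 : 0 ≤ χ := by rw [hχ]; split_ifs <;> simp
  have hpt : ∀ ω, π.pulls H θ.y k ω T ≤ 1 + ∑ t ∈ Finset.range T, (Fail t).indicator 1 ω +
      χ * (w + 1 + ∑ t ∈ Finset.range T, (Over t).indicator 1 ω) := by
    intro ω
    have hterm : ∀ t ∈ Finset.range T, (if π.play H θ.y ω.1 ω.2 t = k then (1 : ℝ) else 0) ≤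
        (if t = (k : ℕ) then 1 else 0) + (Fail t).indicator 1 ω +
        χ * ((if π.play H θ.y ω.1 ω.2 t = k ∧ π.pulls H θ.y k ω t < w then (1 : ℝ) else 0) +
          (Over t).indicator 1 ω) := by
      intro t ht
      have e1 : (0 : ℝ) ≤ if t = (k : ℕ) then 1 else 0 := by split_ifs <;> simp
      have e2 : (0 : ℝ) ≤ (Fail t).indicator 1 ω := Set.indicator_nonneg (by simp) ω
      have e3 : (0 : ℝ) ≤ (Over t).indicator 1 ω := Set.indicator_nonneg (by simp) ω
      have e4 : (0 : ℝ) ≤ if π.play H θ.y ω.1 ω.2 t = k ∧ π.pulls H θ.y k ω t < w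
        then (1 : ℝ) else 0 := by split_ifs <;> simp
      have e5 := mul_nonneg hχ0 (add_nonneg e4 e3)
      by_cases hp : π.play H θ.y ω.1 ω.2 t = k
      swap
      · rw [if_neg hp]
        linarith
      rw [if_pos hp]
      rcases lt_or_ge t K with htK | htK
      · have : t = (k : ℕ) := by
          have := ucb1Plus_play_of_lt σ ahi c H θ.y ω.1 ω.2 htK
          rw [← hp, show π.play H θ.y ω.1 ω.2 t = ⟨t, htK⟩ from this]
        rw [if_pos this]
        linarith
      by_cases hfail : ω ∈ π.underestimated H θ σ c θ.bestArm t
      · have : (Fail t).indicator (1 : π.Seed × (ℕ → Fin K → ℝ) → ℝ) ω = 1 := by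
          rw [Set.indicator_of_mem (show ω ∈ Fail t from ⟨hfail, hp⟩)]
          rfl
        linarith
      obtain ⟨hcont, hor⟩ := contender_of_play hσ hc hH hθ hk ω htK (Finset.mem_range.mp ht)
        hfail hp
      have hχ1 : χ = 1 := by rw [hχ, if_pos hcont]
      rw [hχ1, one_mul]
      rcases hor with hlt | hov
      · rw [if_pos (show π.play H θ.y ω.1 ω.2 t = k ∧ π.pulls H θ.y k ω t < w from ⟨hp, hlt⟩)]
        linarith
      · have : (Over t).indicator (1 : π.Seed × (ℕ → Fin K → ℝ) → ℝ) ω = 1 := by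
          rw [Set.indicator_of_mem (show ω ∈ Over t from ⟨hp, hov⟩)]
          rfl
        linarith
    refine (Finset.sum_le_sum hterm).trans ?_
    rw [Finset.sum_add_distrib, Finset.sum_add_distrib, ← Finset.mul_sum, Finset.sum_add_distrib]
    have h1 : ∑ t ∈ Finset.range T, (if t = (k : ℕ) then (1 : ℝ) else 0) ≤ 1 := by
      rw [Finset.sum_ite_eq']
      split_ifs <;> simp
    have h2 := π.sum_early_pulls_le H θ.y k ω hw0 T
    have h3 := mul_le_mul_of_nonneg_left
      (add_le_add_left h2 (∑ t ∈ Finset.range T, (Over t).indicator (1 : π.Seed × (ℕ → Fin K → ℝ) → ℝ) ω)) hχ0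
    linarith
  have hFi : ∀ t, Integrable ((Fail t).indicator (1 : π.Seed × (ℕ → Fin K → ℝ) → ℝ)) (π.law θ) := fun t =>
    (integrable_const (1 : ℝ)).indicator (hFm t)
  have hOi : ∀ t, Integrable ((Over t).indicator (1 : π.Seed × (ℕ → Fin K → ℝ) → ℝ)) (π.law θ) := fun t =>
    (integrable_const (1 : ℝ)).indicator (hOm t)
  have hFs : Integrable (fun ω => ∑ t ∈ Finset.range T, (Fail t).indicator (1 : π.Seed × (ℕ → Fin K → ℝ) → ℝ) ω)
    (π.law θ) := integrable_finsetSum _ fun t _ => hFi t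
  have hOs : Integrable (fun ω => ∑ t ∈ Finset.range T, (Over t).indicator (1 : π.Seed × (ℕ → Fin K → ℝ) → ℝ) ω)
    (π.law θ) := integrable_finsetSum _ fun t _ => hOi t
  have hmono := integral_mono (μ := π.law θ) (π.integrable_pulls H θ.y θ k T)
    (((integrable_const (1 : ℝ)).add hFs).add
      (((integrable_const (w + 1)).add hOs).const_mul χ)) hpt
  have hFe : ∫ ω, ∑ t ∈ Finset.range T, (Fail t).indicator (1 : π.Seed × (ℕ → Fin K → ℝ) → ℝ) ω ∂(π.law θ) =
      ∑ t ∈ Finset.range T, (π.law θ).real (Fail t) := by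
    rw [integral_finsetSum _ fun t _ => hFi t]
    exact Finset.sum_congr rfl fun t _ => integral_indicator_one (hFm t)
  have hOe : ∫ ω, ∑ t ∈ Finset.range T, (Over t).indicator (1 : π.Seed × (ℕ → Fin K → ℝ) → ℝ) ω ∂(π.law θ) =
      ∑ t ∈ Finset.range T, (π.law θ).real (Over t) := by
    rw [integral_finsetSum _ fun t _ => hOi t]
    exact Finset.sum_congr rfl fun t _ => integral_indicator_one (hOm t)
  have hrhs : ∫ ω, (1 + ∑ t ∈ Finset.range T, (Fail t).indicator (1 : π.Seed × (ℕ → Fin K → ℝ) → ℝ) ω +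
      χ * (w + 1 + ∑ t ∈ Finset.range T, (Over t).indicator (1 : π.Seed × (ℕ → Fin K → ℝ) → ℝ) ω)) ∂(π.law θ) =
      1 + ∑ t ∈ Finset.range T, (π.law θ).real (Fail t) +
        χ * (w + 1 + ∑ t ∈ Finset.range T, (π.law θ).real (Over t)) := by
    have hI1 : Integrable (fun ω => 1 + ∑ t ∈ Finset.range T,
        (Fail t).indicator (1 : π.Seed × (ℕ → Fin K → ℝ) → ℝ) ω) (π.law θ) :=
      (integrable_const (1 : ℝ)).add hFs
    have hI2 : Integrable (fun ω => χ * (w + 1 + ∑ t ∈ Finset.range T,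
        (Over t).indicator (1 : π.Seed × (ℕ → Fin K → ℝ) → ℝ) ω)) (π.law θ) :=
      ((integrable_const (w + 1)).add hOs).const_mul χ
    rw [integral_add hI1 hI2,
      integral_add (integrable_const (1 : ℝ)) hFs, integral_const_mul,
      integral_add (integrable_const (w + 1)) hOs, hFe, hOe]
    simp
  rw [Policy.expectedPulls_eq]
  refine (hmono.trans hrhs.le).trans ?_
  refine add_le_add le_rfl ?_
  by_cases hcont : k ∈ θ.contenders ahi
  · rw [if_pos hcont, hχ, if_pos hcont, one_mul]
    have hq1 : Real.exp (-d) < 1 := by rw [Real.exp_lt_one_iff]; linarith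
    have hO := π.sum_measureReal_le H θ.y θ k hfm (Real.exp_pos (-d)).le hq1
      (lintegral_exp_le_of_subgaussian (hθ.1 k) (g / (2 * σ ^ 2)) d) T
    -- Equivalent to `exp (-d) ≤ 1 / (1 + d)`; it turns the geometric sum into order `1 / gap ^ 2`.
    have hq : 1 / (1 - Real.exp (-d)) ≤ 1 + 1 / d := by
      have h1 : Real.exp (-d) ≤ 1 / (1 + d) := by
        rw [Real.exp_neg, ← one_div]
        exact one_div_le_one_div_of_le (by linarith) (by linarith [Real.add_one_le_exp d])
      rw [div_le_iff₀ (by linarith)]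
      have h2 : (1 + 1 / d) * (1 - 1 / (1 + d)) = 1 := by field_simp; ring
      have h3 : (1 + 1 / d) * (1 - 1 / (1 + d)) ≤ (1 + 1 / d) * (1 - Real.exp (-d)) :=
        mul_le_mul_of_nonneg_left (by linarith) (by positivity)
      linarith
    have hd' : 1 / d = 8 * σ ^ 2 / g ^ 2 := by rw [hd, one_div_div]
    rw [hd'] at hq
    linarith
  · rw [if_neg hcont, hχ, if_neg hcont, zero_mul]

end Analysis

theorem sum_measureReal_underestimated_inter {K : ℕ} {H : ℕ → Fin K → ℕ} {θ : Problem K}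
    {σ : ℝ≥0} {c : ℝ} (π : Policy.{u} K) (j : Fin K) (t : ℕ) :
    ∑ k, (π.law θ).real (π.underestimated H θ σ c j t ∩ {ω | π.play H θ.y ω.1 ω.2 t = k}) =
      (π.law θ).real (π.underestimated H θ σ c j t) := by
  have h := sum_measureReal_preimage_singleton
    (μ := (π.law θ).restrict (π.underestimated H θ σ c j t))
    (f := fun ω => π.play H θ.y ω.1 ω.2 t) Finset.univ
    (fun k _ => π.measurableSet_play_eq H θ.y t k)
  rw [Finset.coe_univ, Set.preimage_univ, measureReal_restrict_apply_univ] at h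
  rw [← h]
  refine Finset.sum_congr rfl fun k _ => ?_
  refine Eq.trans ?_ (measureReal_restrict_apply (π.measurableSet_play_eq H θ.y t k)).symm
  rw [Set.inter_comm]

/-- UCB1+ has logarithmic regret, and pulls each suboptimal arm logarithmically often. -/
theorem exists_ucb1Plus_bounds (σ : ℝ≥0) (hσ : 0 < σ) {c : ℝ} (hc : 2 < c) {B : ℝ} (hB : 0 < B) :
    ∃ A F C : ℝ, 0 < A ∧ 0 < F ∧ 0 < C ∧ ∀ (K : ℕ) [NeZero K] (alo ahi Δ : ℝ)
      (H : ℕ → Fin K → ℕ), (∀ k, H 0 k = 1) →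
      (∀ θ ∈ problemClass K σ alo ahi Δ B, ∀ T : ℕ, 1 ≤ T →
        (ucb1Plus.{u} K σ ahi c).regret H θ T ≤
          ∑ k ∈ θ.contenders ahi, A / θ.gap k * Real.log T + (F + ∑ k, θ.gap k)) ∧
      (ucb1Plus.{u} K σ ahi c).IsIAOWith H (problemClass K σ alo ahi Δ B) C := by
  classical
  obtain ⟨F, hF0, hF⟩ := exists_peel_sum_bound hc
  have hσ' : (0 : ℝ) < σ := hσ
  have hl2 : 0 < Real.log 2 := Real.log_pos (by norm_num)
  -- The quotients by `log 2` absorb terms without `log T` for `2 ≤ T`. In the regret bound `T = 1`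
  -- is separate because its logarithm vanishes.
  refine ⟨4 * c * σ ^ 2 + (2 * B ^ 2 + 8 * σ ^ 2) / Real.log 2, B * F,
    4 * c * σ ^ 2 + ((3 + F) * B ^ 2 + 8 * σ ^ 2) / Real.log 2, by positivity, by positivity,
    by positivity, fun K _ alo ahi Δ H hH => ?_⟩
  set π := ucb1Plus.{u} K σ ahi c with hπ
  have hfail : ∀ θ ∈ problemClass K σ alo ahi Δ B, ∀ T : ℕ, ∑ t ∈ Finset.range T,
      (π.law θ).real (π.underestimated H θ σ c θ.bestArm t) ≤ F := fun θ hθ T =>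
    (Finset.sum_le_sum fun t _ =>
      π.measureReal_underestimated_le H θ hσ hc θ.bestArm (hθ.1 _) t).trans (hF T)
  have hlogT : ∀ T : ℕ, 2 ≤ T → Real.log 2 ≤ Real.log T := fun T hT =>
    Real.log_le_log (by norm_num) (by exact_mod_cast hT)
  have hscale : ∀ (a : ℝ) (T : ℕ), 0 ≤ a → 2 ≤ T → a ≤ a / Real.log 2 * Real.log T :=
    fun a T ha hT => by
      have := mul_le_mul_of_nonneg_left (hlogT T hT) (show 0 ≤ a / Real.log 2 by positivity)
      rwa [div_mul_cancel₀ _ hl2.ne'] at this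
  constructor
  · intro θ hθ T hT
    rcases Nat.lt_or_ge T 2 with hT2 | hT2
    · obtain rfl : T = 1 := by omega
      have h1 : π.regret H θ 1 ≤ ∑ k, θ.gap k := by
        rw [π.regret_eq]
        refine Finset.sum_le_sum fun k _ => mul_le_of_le_one_right (θ.gap_nonneg k) ?_
        have := integral_mono (π.integrable_pulls H θ.y θ k 1) (integrable_const (1 : ℝ))
          fun ω => by simpa using π.pulls_le H θ.y k ω 1
        simpa [Policy.expectedPulls_eq] using this
      have : 0 < B * F := by positivity
      simp only [Nat.cast_one, Real.log_one, mul_zero, Finset.sum_const_zero]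
      linarith
    set p : Fin K → ℕ → ℝ := fun k t => (π.law θ).real
      (π.underestimated H θ σ c θ.bestArm t ∩ {ω | π.play H θ.y ω.1 ω.2 t = k}) with hp
    have hp0 : ∀ k t, 0 ≤ p k t := fun k t => measureReal_nonneg
    have hk : ∀ k, θ.gap k * π.expectedPulls H θ k T ≤ θ.gap k +
        B * ∑ t ∈ Finset.range T, p k t +
        if k ∈ θ.contenders ahi then
          (4 * c * σ ^ 2 + (2 * B ^ 2 + 8 * σ ^ 2) / Real.log 2) / θ.gap k * Real.log T
          else 0 := by
      intro k
      have hs0 : 0 ≤ ∑ t ∈ Finset.range T, p k t := Finset.sum_nonneg fun t _ => hp0 k t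
      have hgB := hθ.2.2.2.2 k
      by_cases hkb : k = θ.bestArm
      · have : k ∉ θ.contenders ahi := fun h => (θ.mem_contenders.mp h).1 hkb
        rw [if_neg this, hkb, θ.gap_bestArm, ← hkb]
        have := mul_nonneg hB.le hs0
        linarith
      have hg : 0 < θ.gap k := (hθ.2.2.2.1 k hkb).1
      have h := mul_le_mul_of_nonneg_left
        (expectedPulls_ucb1Plus_le.{u} (H := H) hσ (by linarith : 0 < c) hH hθ hkb hT) hg.le
      refine h.trans ?_
      rw [mul_add, mul_add, mul_one]
      refine add_le_add (add_le_add le_rfl (mul_le_mul_of_nonneg_right hgB hs0)) ?_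
      split_ifs with hcont
      · have h1 : θ.gap k * (4 * c * σ ^ 2 * Real.log T / θ.gap k ^ 2 + 2 +
            8 * σ ^ 2 / θ.gap k ^ 2) =
            (4 * c * σ ^ 2 * Real.log T + (2 * θ.gap k ^ 2 + 8 * σ ^ 2)) / θ.gap k := by
          field_simp
          ring
        rw [h1, div_mul_eq_mul_div]
        refine div_le_div_of_nonneg_right ?_ hg.le
        have h2 : θ.gap k ^ 2 ≤ B ^ 2 := pow_le_pow_left₀ hg.le hgB 2
        have h3 := hscale (2 * B ^ 2 + 8 * σ ^ 2) T (by positivity) hT2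
        linarith
      · simp
    rw [π.regret_eq]
    refine (Finset.sum_le_sum fun k _ => hk k).trans ?_
    rw [Finset.sum_add_distrib, Finset.sum_add_distrib, ← Finset.mul_sum, Finset.sum_comm,
      Finset.sum_ite_mem, Finset.univ_inter]
    -- The arm played partitions the failure event, so `F` is paid once and not `K` times.
    have h1 : ∑ t ∈ Finset.range T, ∑ k, p k t ≤ F := by
      refine le_trans (le_of_eq (Finset.sum_congr rfl fun t _ => ?_)) (hfail θ hθ T)
      exact sum_measureReal_underestimated_inter π θ.bestArm t
    have h2 := mul_le_mul_of_nonneg_left h1 hB.le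
    linarith
  · intro θ hθ k hkb T hT
    have hg : 0 < θ.gap k := (hθ.2.2.2.1 k hkb).1
    have hgB := hθ.2.2.2.2 k
    refine (expectedPulls_ucb1Plus_le.{u} (H := H) hσ (by linarith : 0 < c) hH hθ hkb
      (by omega)).trans ?_
    have h1 : ∑ t ∈ Finset.range T, (π.law θ).real
        (π.underestimated H θ σ c θ.bestArm t ∩ {ω | π.play H θ.y ω.1 ω.2 t = k}) ≤ F :=
      (Finset.sum_le_sum fun t _ => measureReal_mono Set.inter_subset_left
        (measure_ne_top _ _)).trans (hfail θ hθ T)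
    have hlog0 : 0 ≤ Real.log T := hl2.le.trans (hlogT T hT)
    have h2 : (if k ∈ θ.contenders ahi then
        4 * c * σ ^ 2 * Real.log T / θ.gap k ^ 2 + 2 + 8 * σ ^ 2 / θ.gap k ^ 2 else 0) ≤
        4 * c * σ ^ 2 * Real.log T / θ.gap k ^ 2 + 2 + 8 * σ ^ 2 / θ.gap k ^ 2 := by
      split_ifs
      · exact le_rfl
      · positivity
    refine (add_le_add (add_le_add le_rfl h1) h2).trans ?_
    have h3 : 1 + F + (4 * c * σ ^ 2 * Real.log T / θ.gap k ^ 2 + 2 + 8 * σ ^ 2 / θ.gap k ^ 2) =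
        (4 * c * σ ^ 2 * Real.log T + ((3 + F) * θ.gap k ^ 2 + 8 * σ ^ 2)) / θ.gap k ^ 2 := by
      field_simp
      ring
    rw [h3, div_mul_eq_mul_div]
    refine div_le_div_of_nonneg_right ?_ (by positivity)
    have h4 : (3 + F) * θ.gap k ^ 2 ≤ (3 + F) * B ^ 2 :=
      mul_le_mul_of_nonneg_left (pow_le_pow_left₀ hg.le hgB 2) (by linarith)
    have h5 := hscale ((3 + F) * B ^ 2 + 8 * σ ^ 2) T (by positivity) hT
    linarith

/-! ### Alternative instances and the lower bound on pulls -/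

/-- The instance `θ` with the reward law of arm `k` replaced by `ρ`. -/
noncomputable def Problem.replaceArm {K : ℕ} (θ : Problem K) (k : Fin K)
    (ρ : ProbabilityMeasure ℝ) : Problem K where
  ν := Function.update θ.ν k ρ
  y := θ.y

section Alternative

variable {K : ℕ} {σ : ℝ≥0} {alo ahi Δ B ε : ℝ} {H : ℕ → Fin K → ℕ} {θ : Problem K}
  {k : Fin K} {ρ : ProbabilityMeasure ℝ}

theorem replaceArm_ν_self : (θ.replaceArm k ρ).ν k = ρ := Function.update_self _ _ _

theorem replaceArm_ν_of_ne {j : Fin K} (hj : j ≠ k) : (θ.replaceArm k ρ).ν j = θ.ν j :=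
  Function.update_of_ne hj _ _

theorem replaceArm_mean_self : (θ.replaceArm k ρ).mean k = ∫ x, x ∂(ρ : Measure ℝ) := by
  rw [Problem.mean, replaceArm_ν_self]

theorem replaceArm_mean_of_ne {j : Fin K} (hj : j ≠ k) :
    (θ.replaceArm k ρ).mean j = θ.mean j := by
  rw [Problem.mean, replaceArm_ν_of_ne hj, Problem.mean]

variable [NeZero K]

theorem replaceArm_bestArm (hε : 0 < ε)
    (hρ : ∫ x, x ∂(ρ : Measure ℝ) = θ.bestMean + ε) : (θ.replaceArm k ρ).bestArm = k := by
  have hlt : ∀ j, j ≠ k → (θ.replaceArm k ρ).mean j < (θ.replaceArm k ρ).mean k := fun j hj => by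
    rw [replaceArm_mean_of_ne hj, replaceArm_mean_self, hρ]
    linarith [θ.mean_le_bestMean j]
  rw [Problem.bestArm, firstArgmax_eq_iff]
  refine ⟨fun j => ?_, fun i hi => ⟨k, hlt i hi.ne⟩⟩
  by_cases hj : j = k
  · rw [hj]
  · exact (hlt j hj).le

theorem replaceArm_gap_of_ne (hε : 0 < ε) (hρ : ∫ x, x ∂(ρ : Measure ℝ) = θ.bestMean + ε)
    {j : Fin K} (hj : j ≠ k) : (θ.replaceArm k ρ).gap j = θ.gap j + ε := by
  rw [Problem.gap, Problem.bestMean, replaceArm_bestArm hε hρ, replaceArm_mean_self,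
    replaceArm_mean_of_ne hj, hρ, Problem.gap]
  ring

/-- With a margin, a contender can be made the best arm without leaving the class. -/
theorem replaceArm_mem_problemClass (hθ : θ ∈ problemClass K σ alo ahi Δ B)
    (hm : HasMargin θ ahi Δ B ε) (hk : k ∈ θ.contenders ahi)
    (hρ : ∫ x, x ∂(ρ : Measure ℝ) = θ.bestMean + ε)
    (hsub : HasSubgaussianMGF (fun x => x - (θ.bestMean + ε)) (σ ^ 2) (ρ : Measure ℝ)) :
    θ.replaceArm k ρ ∈ problemClass K σ alo ahi Δ B := by
  obtain ⟨h1, h2, h3, h4, h5⟩ := hθ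
  obtain ⟨hε, hΔε, hmar⟩ := hm
  obtain ⟨hkb, hkc⟩ := θ.mem_contenders.mp hk
  have hcap : θ.bestMean + ε ≤ ahi * θ.y k :=
    (hmar k hkb).2.2.resolve_left (not_lt.mpr hkc)
  refine ⟨fun j => ?_, h2, fun j => ?_, fun j hj => ?_, fun j => ?_⟩
  · by_cases hj : j = k
    · subst hj
      rw [replaceArm_mean_self, replaceArm_ν_self, hρ]
      exact hsub
    · rw [replaceArm_mean_of_ne hj, replaceArm_ν_of_ne hj]
      exact h1 j
  · by_cases hj : j = k
    · subst hj
      rw [replaceArm_mean_self, hρ]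
      change ∃ a ∈ Set.Icc alo ahi, a * θ.y j = θ.bestMean + ε
      obtain ⟨a, ha, haj⟩ := h3 j
      have hle := θ.mean_le_bestMean j
      -- If `y j = 0`, the mean of `j` is `0` and the cap gives `bestMean + ε ≤ 0`, contradicting
      -- that `bestMean` is at least that mean.
      have hy : 0 < θ.y j := by
        rcases (h2 j).lt_or_eq with h | h
        · exact h
        · rw [← h] at haj hcap
          linarith
      refine ⟨(θ.bestMean + ε) / θ.y j, ⟨?_, ?_⟩, div_mul_cancel₀ _ hy.ne'⟩
      · rw [le_div_iff₀ hy]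
        have := mul_le_mul_of_nonneg_right ha.1 hy.le
        linarith
      · rwa [div_le_iff₀ hy]
    · rw [replaceArm_mean_of_ne hj]
      exact h3 j
  · rw [replaceArm_bestArm hε hρ] at hj
    rw [replaceArm_gap_of_ne hε hρ hj]
    have := θ.gap_nonneg j
    constructor <;> linarith
  · by_cases hj : j = k
    · have hb := (θ.replaceArm k ρ).gap_bestArm
      rw [replaceArm_bestArm hε hρ] at hb
      rw [hj, hb]
      exact (θ.gap_nonneg k).trans (h5 k)
    · rw [replaceArm_gap_of_ne hε hρ hj]
      by_cases hjb : j = θ.bestArm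
      · have := hmar k hkb
        have := θ.gap_nonneg k
        rw [hjb, θ.gap_bestArm]
        linarith
      · exact (hmar j hjb).2.1

/-- An information-agnostic-optimal policy has to pull each contender logarithmically often, at a
rate given by the information cost of making it the best arm. -/
theorem pulls_lower_bound (hθ : θ ∈ problemClass K σ alo ahi Δ B)
    (hm : HasMargin θ ahi Δ B ε) (hk : k ∈ θ.contenders ahi)
    (hρ : ∫ x, x ∂(ρ : Measure ℝ) = θ.bestMean + ε)
    (hsub : HasSubgaussianMGF (fun x => x - (θ.bestMean + ε)) (σ ^ 2) (ρ : Measure ℝ))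
    {g : ℝ → ℝ} (hg : Measurable g) (hint : Integrable g (θ.ν k : Measure ℝ))
    (hdom : (θ.ν k : Measure ℝ).withDensity (fun x => ENNReal.ofReal (Real.exp (-g x))) ≤
      (ρ : Measure ℝ)) (π : Policy.{u} K) {C : ℝ} (hC : 0 < C)
    (hπ : π.IsIAOWith H (problemClass K σ alo ahi Δ B) C) {T : ℕ} (hT : 2 ≤ T) :
    (T : ℝ) / 4 ≤ π.expectedPulls H θ k T ∨
      Real.log T / 2 ≤
        2 * ((∫ x, g x ∂(θ.ν k : Measure ℝ)) * π.expectedPulls H θ k T + 1) +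
          Real.log (8 * K * C / ε ^ 2) := by
  classical
  have hε : 0 < ε := hm.1
  have hT0 : (0 : ℝ) < T := by exact_mod_cast (by omega : 0 < T)
  have hK0 : (0 : ℝ) < K := by exact_mod_cast Nat.pos_of_ne_zero (NeZero.ne K)
  set θ' := θ.replaceArm k ρ with hθ'
  have hmem : θ' ∈ problemClass K σ alo ahi Δ B := replaceArm_mem_problemClass hθ hm hk hρ hsub
  have hNm := π.measurable_pulls H θ.y k T
  -- If this event is unlikely under `θ`, arm `k` is already pulled linearly often. If it is likely,
  -- the change of measure applies, because an IAO policy makes it rare under `θ'`, where `k` is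
  -- best.
  set E : Set (π.Seed × (ℕ → Fin K → ℝ)) := {ω | π.pulls H θ.y k ω T ≤ T / 2} with hEdef
  have hE : MeasurableSet E := measurableSet_le hNm measurable_const
  have hlog0 : 0 ≤ Real.log T := Real.log_nonneg (by exact_mod_cast (by omega : 1 ≤ T))
  by_cases hhalf : 1 / 2 ≤ (π.law θ).real E
  swap
  · left
    have hcompl : 1 / 2 ≤ (π.law θ).real Eᶜ := by
      rw [probReal_compl_eq_one_sub hE]
      linarith
    have hmono := integral_mono (μ := π.law θ)
      ((integrable_const ((T : ℝ) / 2)).indicator hE.compl) (π.integrable_pulls H θ.y θ k T)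
      fun ω => by
        by_cases hω : ω ∈ E
        · rw [Set.indicator_of_notMem (by simpa using hω)]
          exact π.pulls_nonneg H θ.y k ω T
        · rw [Set.indicator_of_mem (by simpa using hω)]
          exact (not_le.mp hω).le
    rw [integral_indicator_const _ hE.compl, smul_eq_mul] at hmono
    rw [Policy.expectedPulls_eq]
    nlinarith
  right
  have hlow := π.exp_neg_le_measureReal H θ θ' k hg hint
    (fun j hj => (replaceArm_ν_of_ne hj).symm) (by rw [hθ', replaceArm_ν_self]; exact hdom) T hE
    (fun u X X' h => by
      simp only [hEdef, Set.mem_ofPred_eq]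
      rw [π.pulls_congr H θ.y k u T h]) hhalf
  have hup : (π.law θ').real E * (T / 2) ≤ K * (C / ε ^ 2 * Real.log T) := by
    have hmono := integral_mono (μ := π.law θ')
      ((integrable_const ((T : ℝ) / 2)).indicator hE)
      ((integrable_const (T : ℝ)).sub (π.integrable_pulls H θ.y θ' k T))
      fun ω => by
        change _ ≤ (T : ℝ) - π.pulls H θ.y k ω T
        by_cases hω : ω ∈ E
        · rw [Set.indicator_of_mem hω]
          have : π.pulls H θ.y k ω T ≤ T / 2 := hω
          linarith
        · rw [Set.indicator_of_notMem hω]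
          linarith [π.pulls_le H θ.y k ω T]
    rw [integral_indicator_const _ hE, smul_eq_mul,
      integral_sub' (integrable_const _) (π.integrable_pulls H θ.y θ' k T)] at hmono
    have hsum := π.sum_expectedPulls H θ' T
    rw [← Finset.add_sum_erase _ _ (Finset.mem_univ k)] at hsum
    have hrest : ∑ j ∈ Finset.univ.erase k, π.expectedPulls H θ' j T ≤
        ∑ _j ∈ Finset.univ.erase k, C / ε ^ 2 * Real.log T := by
      refine Finset.sum_le_sum fun j hj => ?_
      have hjk := Finset.ne_of_mem_erase hj
      refine (hπ θ' hmem j (by rwa [hθ', replaceArm_bestArm hε hρ]) T hT).trans ?_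
      refine mul_le_mul_of_nonneg_right ?_ hlog0
      rw [hθ', replaceArm_gap_of_ne hε hρ hjk]
      refine div_le_div_of_nonneg_left hC.le (by positivity) ?_
      exact pow_le_pow_left₀ hε.le (by linarith [θ.gap_nonneg j]) 2
    rw [Finset.sum_const, nsmul_eq_mul] at hrest
    have hcard : (((Finset.univ : Finset (Fin K)).erase k).card : ℝ) ≤ K := by
      exact_mod_cast (Finset.card_le_univ _).trans (by simp)
    have hrest' : (((Finset.univ : Finset (Fin K)).erase k).card : ℝ) *
        (C / ε ^ 2 * Real.log T) ≤ K * (C / ε ^ 2 * Real.log T) :=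
      mul_le_mul_of_nonneg_right hcard (by positivity)
    have hEk : π.expectedPulls H θ' k T = ∫ ω, π.pulls H θ.y k ω T ∂(π.law θ') := rfl
    simp only [integral_const, probReal_univ, smul_eq_mul, one_mul] at hmono
    linarith
  set a := 2 * ((∫ x, g x ∂(θ.ν k : Measure ℝ)) * π.expectedPulls H θ k T + 1) with ha
  -- The factor `log T` in the upper bound is absorbed by `log T ≤ 2 * √T`, at the price of half of
  -- `log T` in the conclusion.
  set r := √(T : ℝ) with hr
  have hr0 : 0 < r := Real.sqrt_pos.mpr hT0
  have hrT : r ^ 2 = T := Real.sq_sqrt hT0.le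
  have hlogr : Real.log T = 2 * Real.log r := by
    rw [← hrT, Real.log_pow]
    norm_num
  have hlogle : Real.log T ≤ 2 * r := by
    rw [hlogr]
    linarith [Real.log_le_sub_one_of_pos hr0]
  have hchain : Real.exp (-a) * r ≤ 8 * K * C / ε ^ 2 := by
    have h1 : 1 / 2 * Real.exp (-a) * (T / 2) ≤ K * (C / ε ^ 2 * (2 * r)) := by
      refine (mul_le_mul_of_nonneg_right hlow (by positivity)).trans (hup.trans ?_)
      have : 0 ≤ C / ε ^ 2 := by positivity
      gcongr
    rw [← hrT] at h1
    have h2 : Real.exp (-a) * r * r ≤ 8 * K * C / ε ^ 2 * r := by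
      have : K * (C / ε ^ 2 * (2 * r)) * 4 = 8 * K * C / ε ^ 2 * r := by ring
      nlinarith
    exact le_of_mul_le_mul_right h2 hr0
  have hfin := Real.log_le_log (by positivity) hchain
  rw [Real.log_mul (Real.exp_pos _).ne' hr0.ne', Real.log_exp] at hfin
  rw [hlogr]
  linarith

end Alternative

/-! ### Gaussian shifts: likelihood ratio and relative entropy -/

section Gaussian

theorem gaussianReal_withDensity_shift {σ : ℝ≥0} (hσ : 0 < σ) (m d : ℝ) :
    (gaussianReal m (σ ^ 2)).withDensity (fun x => ENNReal.ofReal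
      (Real.exp (-((d ^ 2 / 2 - d * (x - m)) / (σ : ℝ) ^ 2)))) = gaussianReal (m + d) (σ ^ 2) := by
  have hv : σ ^ 2 ≠ 0 := (pow_pos hσ 2).ne'
  have hσ' : (0 : ℝ) < σ := hσ
  rw [gaussianReal_of_var_ne_zero _ hv, gaussianReal_of_var_ne_zero _ hv,
    ← withDensity_mul _ (measurable_gaussianPDF _ _) (by fun_prop)]
  congr 1
  funext x
  rw [Pi.mul_apply, gaussianPDF, gaussianPDF,
    ← ENNReal.ofReal_mul (gaussianPDFReal_nonneg _ _ _)]
  congr 1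
  rw [gaussianPDFReal, gaussianPDFReal, mul_assoc, ← Real.exp_add]
  congr 2
  push_cast
  field_simp
  ring

theorem hasSubgaussianMGF_gaussianReal (σ : ℝ≥0) (m : ℝ) :
    HasSubgaussianMGF (fun x => x - m) (σ ^ 2) (gaussianReal m (σ ^ 2)) := by
  have hexp : ∀ t : ℝ, (fun x : ℝ => Real.exp (t * (x - m))) =
      fun x => Real.exp (t * x) * Real.exp (-(t * m)) := fun t => by
    funext x
    rw [← Real.exp_add]
    ring_nf
  refine ⟨fun t => ?_, fun t => ?_⟩
  · rw [hexp]
    exact (integrable_exp_mul_gaussianReal t).mul_const _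
  · have h := congrFun (mgf_fun_id_gaussianReal (μ := m) (v := σ ^ 2)) t
    rw [mgf] at h ⊢
    rw [hexp, integral_mul_const, h, ← Real.exp_add]
    refine le_of_eq ?_
    ring_nf

theorem integrable_id_gaussianReal' (m : ℝ) (v : ℝ≥0) :
    Integrable (fun x : ℝ => x) (gaussianReal m v) :=
  (memLp_id_gaussianReal' 1 (by simp)).integrable le_rfl

theorem integral_gaussian_logRatio (σ : ℝ≥0) (m d : ℝ) :
    Integrable (fun x : ℝ => (d ^ 2 / 2 - d * (x - m)) / (σ : ℝ) ^ 2) (gaussianReal m (σ ^ 2)) ∧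
    ∫ x, (d ^ 2 / 2 - d * (x - m)) / (σ : ℝ) ^ 2 ∂(gaussianReal m (σ ^ 2)) =
      d ^ 2 / (2 * σ ^ 2) := by
  have hi := integrable_id_gaussianReal' m (σ ^ 2)
  have h1 : Integrable (fun x : ℝ => d * (x - m)) (gaussianReal m (σ ^ 2)) :=
    (hi.sub (integrable_const m)).const_mul d
  refine ⟨((integrable_const _).sub h1).div_const _, ?_⟩
  rw [integral_div, integral_sub (integrable_const _) h1, integral_const_mul,
    integral_sub hi (integrable_const m), integral_id_gaussianReal]
  simp
  ring

end Gaussian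

/-! ### Alternatives for arbitrary sub-Gaussian laws -/

section General

theorem exp_le_one_add_add_sq (t : ℝ) : Real.exp t ≤ 1 + t + t ^ 2 * Real.exp |t| := by
  have he : 1 ≤ Real.exp |t| := Real.one_le_exp (abs_nonneg t)
  rcases le_or_gt |t| 1 with h | h
  · have h1 := (abs_le.mp (Real.abs_exp_sub_one_sub_id_le h)).2
    nlinarith [sq_nonneg t]
  · have hsq : 1 ≤ t ^ 2 := by
      rw [← sq_abs]
      nlinarith
    rcases le_or_gt 0 t with h0 | h0
    · rw [abs_of_nonneg h0] at *
      nlinarith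
    · have h2 : Real.exp t ≤ 1 := Real.exp_le_one_iff.mpr h0.le
      rw [abs_of_neg h0] at h he
      rw [abs_of_neg h0]
      nlinarith [mul_le_mul_of_nonneg_left he (sq_nonneg t)]

theorem exp_mul_le_of_abs_le_one {l : ℝ} (hl : |l| ≤ 1) (t : ℝ) :
    Real.exp (l * t) ≤ 1 + l * t + l ^ 2 * (t ^ 2 * Real.exp |t|) := by
  refine (exp_le_one_add_add_sq (l * t)).trans ?_
  have h1 : Real.exp |l * t| ≤ Real.exp |t| := by
    rw [Real.exp_le_exp, abs_mul]
    exact mul_le_of_le_one_left (abs_nonneg t) hl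
  have h2 := mul_le_mul_of_nonneg_left h1 (sq_nonneg (l * t))
  rw [mul_pow] at h2 ⊢
  linarith

/-- For small `l` the first-order terms cancel, since the mixture is centred, and the second-order
ones are small. For `|l| > 1` both parts are controlled by `exp (3 * σ ^ 2 * l ^ 2 / 8)`, and the
spare `σ ^ 2 * l ^ 2 / 8` in the exponent absorbs the factor `1 + q * e`. -/
theorem mixture_exp_le {σ q s a V Z r l Φ e : ℝ} (hq0 : 0 < q) (hs0 : 0 < s)
    (hs1 : s ≤ 1) (hqZ : q * Z + s = 1) (hsr : s * r = -(q * a)) (hr : |r| ≤ σ ^ 2 / 8)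
    (hV : q * V + s * (r ^ 2 * Real.exp |r|) ≤ σ ^ 2 / 8) (he : q * e ≤ σ ^ 2 / 8)
    (hsmall : |l| ≤ 1 → Φ ≤ Z + l * a + l ^ 2 * V)
    (hlarge : Φ ≤ Real.exp (3 * σ ^ 2 * l ^ 2 / 8) * e) :
    q * Φ + s * Real.exp (l * r) ≤ Real.exp (σ ^ 2 * l ^ 2 / 2) := by
  have hlσ := mul_nonneg (sq_nonneg l) (sq_nonneg σ)
  rcases le_or_gt |l| 1 with hl | hl
  · have h1 := mul_le_mul_of_nonneg_left (hsmall hl) hq0.le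
    have h2 := mul_le_mul_of_nonneg_left (exp_mul_le_of_abs_le_one hl r) hs0.le
    have e1 : q * (Z + l * a + l ^ 2 * V) + s * (1 + l * r + l ^ 2 * (r ^ 2 * Real.exp |r|)) =
        (q * Z + s) + l * (q * a + s * r) + l ^ 2 * (q * V + s * (r ^ 2 * Real.exp |r|)) := by
      ring
    rw [hqZ, hsr, add_neg_cancel, mul_zero, add_zero] at e1
    have e3 := mul_le_mul_of_nonneg_left hV (sq_nonneg l)
    have hexp := Real.add_one_le_exp (σ ^ 2 * l ^ 2 / 2)
    linarith
  · have h3 : |l| ≤ l ^ 2 := by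
      rw [← sq_abs]
      nlinarith
    have hdir : s * Real.exp (l * r) ≤ Real.exp (3 * σ ^ 2 * l ^ 2 / 8) := by
      refine (mul_le_of_le_one_left (Real.exp_pos _).le hs1).trans (Real.exp_le_exp.mpr ?_)
      have h1 : l * r ≤ |l| * |r| := by
        rw [← abs_mul]
        exact le_abs_self _
      have h2 := mul_le_mul_of_nonneg_left hr (abs_nonneg l)
      have h4 : |l| * (σ ^ 2 / 8) ≤ l ^ 2 * (σ ^ 2 / 8) :=
        mul_le_mul_of_nonneg_right h3 (by positivity)
      linarith
    set P := Real.exp (3 * σ ^ 2 * l ^ 2 / 8) with hP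
    have hP0 : 0 < P := Real.exp_pos _
    have hmain : Real.exp (σ ^ 2 * l ^ 2 / 2) = P * Real.exp (σ ^ 2 * l ^ 2 / 8) := by
      rw [hP, ← Real.exp_add]
      ring_nf
    rw [hmain]
    have h5 : 1 + q * e ≤ Real.exp (σ ^ 2 * l ^ 2 / 8) := by
      have := Real.add_one_le_exp (σ ^ 2 * l ^ 2 / 8)
      have hl2 : 1 ≤ l ^ 2 := hl.le.trans h3
      have := mul_le_mul_of_nonneg_left hl2 (show 0 ≤ σ ^ 2 / 8 by positivity)
      linarith
    have h6 := mul_le_mul_of_nonneg_left h5 hP0.le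
    have h7 := mul_le_mul_of_nonneg_left hlarge hq0.le
    linarith

/-- The law `ν` damped by a Gaussian factor around `m`. -/
noncomputable def damped (ν : Measure ℝ) (m : ℝ) (σ : ℝ≥0) : Measure ℝ :=
  ν.withDensity fun x => ENNReal.ofReal (Real.exp (-((x - m) ^ 2 / (σ : ℝ) ^ 2)))

theorem damped_le {ν : Measure ℝ} {m : ℝ} {σ : ℝ≥0} : damped ν m σ ≤ ν := by
  refine (withDensity_mono (g := fun _ => 1) (Filter.Eventually.of_forall fun x => ?_)).trans ?_
  · rw [← ENNReal.ofReal_one]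
    refine ENNReal.ofReal_le_ofReal (Real.exp_le_one_iff.mpr ?_)
    have : 0 ≤ (x - m) ^ 2 / (σ : ℝ) ^ 2 := by positivity
    linarith
  · exact le_of_eq withDensity_one

variable {ν : Measure ℝ} [IsProbabilityMeasure ν] {m : ℝ} {σ : ℝ≥0}

instance : IsFiniteMeasure (damped ν m σ) := isFiniteMeasure_of_le ν damped_le

/-- Completing the square against the damping costs `σ ^ 2 * l ^ 2 / 4`, and the shift by `d`
another `σ ^ 2 * l ^ 2 / 8`. The total is strictly below the allowed `σ ^ 2 * l ^ 2 / 2`, which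
leaves room for the mixture. -/
theorem integral_exp_damped_le (hσ : 0 < σ) (d l : ℝ) :
    ∫ x, Real.exp (l * (x - (m + d))) ∂(damped ν m σ) ≤
      Real.exp (3 * (σ : ℝ) ^ 2 * l ^ 2 / 8 + 2 * d ^ 2 / (σ : ℝ) ^ 2) := by
  have hσ' : (0 : ℝ) < σ := hσ
  have hnn : ∀ᵐ x ∂(damped ν m σ), 0 ≤ Real.exp (l * (x - (m + d))) :=
    Filter.Eventually.of_forall fun x => (Real.exp_pos _).le
  have hmeas : Measurable fun x : ℝ => ENNReal.ofReal (Real.exp (l * (x - (m + d)))) := by fun_prop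
  rw [integral_eq_lintegral_of_nonneg_ae hnn
    (by fun_prop : Measurable fun x : ℝ => Real.exp (l * (x - (m + d)))).aestronglyMeasurable]
  refine ENNReal.toReal_le_of_le_ofReal (Real.exp_pos _).le ?_
  unfold damped
  rw [lintegral_withDensity_eq_lintegral_mul _ (by fun_prop) hmeas]
  refine (lintegral_mono (g := fun _ => ENNReal.ofReal (Real.exp
    (3 * (σ : ℝ) ^ 2 * l ^ 2 / 8 + 2 * d ^ 2 / (σ : ℝ) ^ 2))) fun x => ?_).trans (by simp)
  rw [Pi.mul_apply, ← ENNReal.ofReal_mul (Real.exp_pos _).le, ← Real.exp_add]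
  refine ENNReal.ofReal_le_ofReal (Real.exp_le_exp.mpr ?_)
  have h1 : l * (x - m) ≤ (x - m) ^ 2 / (σ : ℝ) ^ 2 + (σ : ℝ) ^ 2 * l ^ 2 / 4 := by
    have : (x - m) ^ 2 / (σ : ℝ) ^ 2 + (σ : ℝ) ^ 2 * l ^ 2 / 4 - l * (x - m) =
        ((x - m) / σ - σ * l / 2) ^ 2 := by
      field_simp
      ring
    linarith [sq_nonneg ((x - m) / σ - σ * l / 2)]
  have h2 : -(l * d) ≤ (σ : ℝ) ^ 2 * l ^ 2 / 8 + 2 * d ^ 2 / (σ : ℝ) ^ 2 := by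
    have : (σ : ℝ) ^ 2 * l ^ 2 / 8 + 2 * d ^ 2 / (σ : ℝ) ^ 2 + l * d =
        2 * (σ * l / 4 + d / σ) ^ 2 := by
      field_simp
      ring
    linarith [sq_nonneg (σ * l / 4 + d / σ)]
  linarith

/-- Any sub-Gaussian law is at finite information distance from a sub-Gaussian law, with the same
variance proxy, of any prescribed mean. -/
theorem exists_subgaussian_alternative (hσ : 0 < σ)
    (hν : HasSubgaussianMGF (fun x => x - m) (σ ^ 2) ν) (m' : ℝ) :
    ∃ (ρ : ProbabilityMeasure ℝ) (g : ℝ → ℝ), ∫ x, x ∂(ρ : Measure ℝ) = m' ∧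
      HasSubgaussianMGF (fun x => x - m') (σ ^ 2) (ρ : Measure ℝ) ∧ Measurable g ∧
      Integrable g ν ∧
      ν.withDensity (fun x => ENNReal.ofReal (Real.exp (-g x))) ≤ (ρ : Measure ℝ) := by
  have hσ' : (0 : ℝ) < σ := hσ
  set η := damped ν m σ with hη
  set d := m' - m with hd
  have hexpν : ∀ l : ℝ, Integrable (fun x => Real.exp (l * (x - m'))) ν := fun l => by
    have := (hν.integrable_exp_mul l).mul_const (Real.exp (-(l * d)))
    refine this.congr (Filter.Eventually.of_forall fun x => ?_)
    simp only
    rw [← Real.exp_add]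
    congr 1
    rw [hd]
    ring
  have hexpη : ∀ l : ℝ, Integrable (fun x => Real.exp (l * (x - m'))) η := fun l =>
    (hexpν l).mono_measure damped_le
  have hid : Integrable (fun x : ℝ => x - m) ν := hν.integrable
  have hidη : Integrable (fun x : ℝ => x - m') η := by
    refine Integrable.mono_measure ?_ damped_le
    have := hid.sub (integrable_const d)
    refine this.congr (Filter.Eventually.of_forall fun x => ?_)
    simp only [Pi.sub_apply, hd]
    ring
  have hsqη : Integrable (fun x : ℝ => (x - m') ^ 2 * Real.exp |x - m'|) η := by
    refine Integrable.mono' (((hexpη 2).add (hexpη (-2))).const_mul 2)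
      (by fun_prop) (Filter.Eventually.of_forall fun x => ?_)
    rw [Real.norm_of_nonneg (by positivity), Pi.add_apply]
    have h1 : (x - m') ^ 2 ≤ 2 * Real.exp |x - m'| := by
      have := Real.quadratic_le_exp_of_nonneg (abs_nonneg (x - m'))
      rw [sq_abs] at this
      linarith [abs_nonneg (x - m')]
    have h2 : Real.exp |x - m'| * Real.exp |x - m'| ≤
        Real.exp (2 * (x - m')) + Real.exp (-2 * (x - m')) := by
      rw [← Real.exp_add]
      rcases abs_cases (x - m') with ⟨h, _⟩ | ⟨h, _⟩
      · rw [h, ← two_mul]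
        linarith [Real.exp_pos (-2 * (x - m'))]
      · rw [h, show -(x - m') + -(x - m') = -2 * (x - m') by ring]
        linarith [Real.exp_pos (2 * (x - m'))]
    nlinarith [Real.exp_pos |x - m'|]
  set Z := η.real Set.univ with hZ
  have hZ0 : 0 ≤ Z := measureReal_nonneg
  have hZ1 : Z ≤ 1 := by
    have h : η Set.univ ≤ 1 := (damped_le Set.univ).trans_eq measure_univ
    exact ENNReal.toReal_le_of_le_ofReal zero_le_one (by rwa [ENNReal.ofReal_one])
  set a := ∫ x, (x - m') ∂η with ha
  set V := ∫ x, (x - m') ^ 2 * Real.exp |x - m'| ∂η with hV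
  have hV0 : 0 ≤ V := integral_nonneg fun x => by positivity
  set e0 := Real.exp (2 * d ^ 2 / (σ : ℝ) ^ 2) with he0
  -- `Q` collects every quantity that the weight `q` of the damped part has to make small:
  -- second-order terms, displacement of the atom, and large-`l` factor.
  set Q := 1 + V + 2 * a ^ 2 * Real.exp |a| + 2 * |a| + e0 with hQ
  have hQa : 0 ≤ 2 * a ^ 2 * Real.exp |a| := by positivity
  have hQe : 0 < e0 := Real.exp_pos _
  have hQ0 : 0 < Q := by positivity
  obtain ⟨q, hq0, hq2, hqQ⟩ : ∃ q : ℝ, 0 < q ∧ q ≤ 1 / 2 ∧ q * Q ≤ (σ : ℝ) ^ 2 / 8 := by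
    refine ⟨min (1 / 2) ((σ : ℝ) ^ 2 / 8 / Q), lt_min (by norm_num) (by positivity),
      min_le_left _ _, ?_⟩
    rw [← le_div_iff₀ hQ0]
    exact min_le_right _ _
  have hqV : q * (V + 2 * a ^ 2 * Real.exp |a|) ≤ (σ : ℝ) ^ 2 / 8 := by
    refine le_trans (mul_le_mul_of_nonneg_left ?_ hq0.le) hqQ
    rw [hQ]
    linarith [abs_nonneg a]
  have hqa : 2 * q * |a| ≤ (σ : ℝ) ^ 2 / 8 := by
    refine le_trans ?_ hqQ
    rw [mul_comm 2 q, mul_assoc]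
    refine mul_le_mul_of_nonneg_left ?_ hq0.le
    rw [hQ]
    linarith
  have hqe : q * e0 ≤ (σ : ℝ) ^ 2 / 8 := by
    refine le_trans (mul_le_mul_of_nonneg_left ?_ hq0.le) hqQ
    rw [hQ]
    linarith [abs_nonneg a]
  set s := 1 - q * Z with hs
  have hs2 : 1 / 2 ≤ s := by
    rw [hs]
    nlinarith
  have hs0 : 0 < s := by linarith
  have hs1 : s ≤ 1 := by
    rw [hs]
    nlinarith
  set r := -(q * a) / s with hr
  have hsr : s * r = -(q * a) := mul_div_cancel₀ _ hs0.ne'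
  have hr1 : |r| ≤ 2 * q * |a| := by
    rw [hr, abs_div, abs_neg, abs_mul, abs_of_pos hq0, abs_of_pos hs0, div_le_iff₀ hs0]
    have : 0 ≤ q * |a| := by positivity
    nlinarith
  have hr2 : |r| ≤ |a| := hr1.trans (by nlinarith [abs_nonneg a])
  -- `s` restores total mass `1` and `r` restores the mean `m'`. The density of the first part alone
  -- gives the cost function below; the atom is why the domination is only an inequality.
  let ρ0 : Measure ℝ := ENNReal.ofReal q • η + ENNReal.ofReal s • Measure.dirac (m' + r)
  have hprob : IsProbabilityMeasure ρ0 := by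
    constructor
    have hη1 : η Set.univ = ENNReal.ofReal Z := by
      rw [hZ, ofReal_measureReal]
    simp only [ρ0, Measure.add_apply, Measure.smul_apply, smul_eq_mul, hη1, measure_univ, mul_one]
    rw [← ENNReal.ofReal_mul hq0.le, ← ENNReal.ofReal_add (by positivity) hs0.le, hs]
    simp
  have hρint : ∀ f : ℝ → ℝ, Measurable f → Integrable f η → Integrable f ρ0 := fun f _ hfi =>
    (hfi.smul_measure ENNReal.ofReal_ne_top).add_measure
      ((integrable_dirac (by simp)).smul_measure ENNReal.ofReal_ne_top)
  have hρ : ∀ f : ℝ → ℝ, Measurable f → Integrable f η →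
      ∫ x, f x ∂ρ0 = q * ∫ x, f x ∂η + s * f (m' + r) := fun f hf hfi => by
    rw [integral_add_measure (hfi.smul_measure ENNReal.ofReal_ne_top)
      ((integrable_dirac (by simp)).smul_measure ENNReal.ofReal_ne_top), integral_smul_measure,
      integral_smul_measure, integral_dirac, ENNReal.toReal_ofReal hq0.le,
      ENNReal.toReal_ofReal hs0.le, smul_eq_mul, smul_eq_mul]
  refine ⟨⟨ρ0, hprob⟩, fun x => (x - m) ^ 2 / (σ : ℝ) ^ 2 - Real.log q, ?_, ⟨fun l => ?_,
    fun l => ?_⟩, by fun_prop, ?_, ?_⟩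
  · change ∫ x, x ∂ρ0 = m'
    have h1 := hρ (fun x => x - m') (by fun_prop) hidη
    have h2 : Integrable (fun x : ℝ => x - m') ρ0 := hρint _ (by fun_prop) hidη
    have h3 : ∫ x, x ∂ρ0 = ∫ x, ((x - m') + m') ∂ρ0 := by simp
    rw [h3, integral_add h2 (integrable_const _), h1, ← ha]
    simp only [add_sub_cancel_left, hsr, integral_const, probReal_univ, one_smul]
    ring
  · exact hρint _ (by fun_prop) (hexpη l)
  · change ∫ x, Real.exp (l * (x - m')) ∂ρ0 ≤ _
    rw [hρ _ (by fun_prop) (hexpη l), add_sub_cancel_left]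
    push_cast
    have hrr : s * (r ^ 2 * Real.exp |r|) ≤ q * (2 * a ^ 2 * Real.exp |a|) := by
      have h1 : r ^ 2 ≤ 2 * q * a ^ 2 := by
        rw [← sq_abs r, ← sq_abs a]
        nlinarith [abs_nonneg r, abs_nonneg a]
      have h3 : r ^ 2 * Real.exp |r| ≤ 2 * q * a ^ 2 * Real.exp |a| :=
        mul_le_mul h1 (Real.exp_le_exp.mpr hr2) (Real.exp_pos _).le (by positivity)
      have h4 : 0 ≤ r ^ 2 * Real.exp |r| := by positivity
      linarith [mul_le_of_le_one_left h4 hs1]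
    refine (mixture_exp_le (σ := σ) (e := e0) (a := a) (V := V) (Z := Z) hq0 hs0 hs1
      (by rw [hs]; ring) hsr (hr1.trans hqa) (by linarith) hqe (fun hl => ?_) ?_).trans_eq
      (by ring_nf)
    · have hi1 : Integrable (fun x : ℝ => 1 + l * (x - m')) η :=
        (integrable_const _).add (hidη.const_mul l)
      have hint := integral_mono (hexpη l) (hi1.add (hsqη.const_mul (l ^ 2)))
        fun x => exp_mul_le_of_abs_le_one hl (x - m')
      refine hint.trans_eq ?_
      rw [integral_add' hi1 (hsqη.const_mul (l ^ 2)), integral_const_mul,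
        integral_add (integrable_const _) (hidη.const_mul l), integral_const_mul]
      simp [hZ, ha, hV]
    · have := integral_exp_damped_le (ν := ν) (m := m) hσ d l
      rw [Real.exp_add] at this
      have hmd : m + d = m' := by rw [hd]; ring
      rwa [hmd] at this
  · have hL2 : Integrable (fun x : ℝ => (x - m) ^ 2) ν := (hν.memLp 2).integrable_sq
    exact (hL2.div_const _).sub (integrable_const _)
  · change _ ≤ ρ0
    have hw : (fun x => ENNReal.ofReal (Real.exp (-((x - m) ^ 2 / (σ : ℝ) ^ 2 - Real.log q)))) =
        ENNReal.ofReal q • fun x =>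
          ENNReal.ofReal (Real.exp (-((x - m) ^ 2 / (σ : ℝ) ^ 2))) := by
      funext x
      rw [Pi.smul_apply, smul_eq_mul, ← ENNReal.ofReal_mul hq0.le,
        show -((x - m) ^ 2 / (σ : ℝ) ^ 2 - Real.log q) =
          Real.log q + -((x - m) ^ 2 / (σ : ℝ) ^ 2) by ring, Real.exp_add, Real.exp_log hq0]
    rw [hw, withDensity_smul _ (by fun_prop)]
    exact Measure.le_add_right le_rfl

end General

/-! ### Asymptotic and finite-time lower bounds for contenders -/

section Optimality

variable {K : ℕ} [NeZero K] {σ : ℝ≥0} {alo ahi Δ B ε : ℝ} {H : ℕ → Fin K → ℕ} {θ : Problem K}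
  {k : Fin K}

theorem sum_contenders_gap_mul_pulls_le (π : Policy.{u} K) (θ : Problem K) (ahi : ℝ)
    (H : ℕ → Fin K → ℕ) (T : ℕ) :
    ∑ k ∈ θ.contenders ahi, θ.gap k * π.expectedPulls H θ k T ≤ π.regret H θ T := by
  rw [π.regret_eq]
  exact Finset.sum_le_sum_of_subset_of_nonneg (Finset.subset_univ _) fun k _ _ =>
    mul_nonneg (θ.gap_nonneg k) (π.expectedPulls_nonneg H θ k T)

/-- The pulls of a contender grow logarithmically, at a rate that does not depend on the policy. -/
theorem exists_pulls_rate (hσ : 0 < σ) (hθ : θ ∈ problemClass K σ alo ahi Δ B)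
    (hm : HasMargin θ ahi Δ B ε) (hk : k ∈ θ.contenders ahi) :
    ∃ r : ℝ, 0 < r ∧ ∀ π : Policy.{u} K, π.IsIAO H (problemClass K σ alo ahi Δ B) →
      ∃ T₀ : ℕ, ∀ T : ℕ, T₀ ≤ T → r * Real.log T ≤ π.expectedPulls H θ k T := by
  obtain ⟨ρ, g, hρ, hsub, hg, hint, hdom⟩ :=
    exists_subgaussian_alternative hσ (hθ.1 k) (θ.bestMean + ε)
  set D := ∫ x, g x ∂(θ.ν k : Measure ℝ)
  have hD0 : 0 < |D| + 1 := by positivity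
  -- The two entries serve the two alternatives of `pulls_lower_bound`. The IAO constant `C` enters
  -- only through the additive term `X`, which affects `T₀` but not the rate.
  refine ⟨min (1 / 4) (1 / (8 * (|D| + 1))), lt_min (by norm_num) (by positivity), ?_⟩
  rintro π ⟨C, hC, hπ⟩
  set X := Real.log (8 * K * C / ε ^ 2)
  have hev := (Real.tendsto_log_atTop.comp tendsto_natCast_atTop_atTop).eventually_ge_atTop
    (4 * (2 + X))
  obtain ⟨T₁, hT₁⟩ := Filter.eventually_atTop.mp hev
  refine ⟨max T₁ 2, fun T hT => ?_⟩
  have hlogT : 4 * (2 + X) ≤ Real.log T := hT₁ T ((le_max_left _ _).trans hT)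
  have hT2 : 2 ≤ T := (le_max_right _ _).trans hT
  have hlog0 : 0 ≤ Real.log T := Real.log_nonneg (by exact_mod_cast (by omega : 1 ≤ T))
  have hn := π.expectedPulls_nonneg H θ k T
  rcases pulls_lower_bound hθ hm hk hρ hsub hg hint hdom π hC hπ hT2 with h | h
  · have h1 : Real.log T ≤ T := Real.log_le_self (Nat.cast_nonneg T)
    have h2 := mul_le_mul_of_nonneg_right (min_le_left (1 / 4) (1 / (8 * (|D| + 1)))) hlog0
    linarith
  · have h1 := mul_le_mul_of_nonneg_right
      (show D ≤ |D| + 1 by linarith [le_abs_self D]) hn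
    have h2 := mul_le_mul_of_nonneg_right (min_le_right (1 / 4) (1 / (8 * (|D| + 1)))) hlog0
    refine h2.trans ?_
    rw [div_mul_eq_mul_div, one_mul, div_le_iff₀ (by positivity)]
    linarith

/-- The finite-time lower bound on the pulls of a contender under Gaussian rewards. -/
theorem log_div_gap_le_of_gaussian (hσ : 0 < σ) (hθ : θ ∈ problemClass K σ alo ahi Δ B)
    (hgauss : ∀ k, (θ.ν k : Measure ℝ) = gaussianReal (θ.mean k) (σ ^ 2))
    (hm : HasMargin θ ahi Δ B ε) (hk : k ∈ θ.contenders ahi) (π : Policy.{u} K) {C : ℝ}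
    (hC : 0 < C) (hπ : π.IsIAOWith H (problemClass K σ alo ahi Δ B) C) {T : ℕ} (hT : 1 ≤ T) :
    Real.log T / θ.gap k ≤
      20 * (1 + Real.log K + Real.log (1 + C) + Real.log (1 + 1 / ε)) * (1 / θ.gap k) +
        (8 + 16 / (σ : ℝ) ^ 2) * (θ.gap k * π.expectedPulls H θ k T) := by
  obtain ⟨hkb, hkc⟩ := θ.mem_contenders.mp hk
  have hσ' : (0 : ℝ) < σ := hσ
  have hε : 0 < ε := hm.1
  have hgε : ε ≤ θ.gap k := (hm.2.2 k hkb).1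
  have hg : 0 < θ.gap k := hε.trans_le hgε
  have hK1 : (1 : ℝ) ≤ K := by exact_mod_cast Nat.one_le_iff_ne_zero.mpr (NeZero.ne K)
  have hlK : 0 ≤ Real.log K := Real.log_nonneg hK1
  have hlC : 0 ≤ Real.log (1 + C) := Real.log_nonneg (by linarith)
  have hiε : 0 < 1 / ε := by positivity
  have hlε : 0 ≤ Real.log (1 + 1 / ε) := Real.log_nonneg (by linarith)
  set L := 1 + Real.log K + Real.log (1 + C) + Real.log (1 + 1 / ε) with hL
  have hn := π.expectedPulls_nonneg H θ k T
  set n := π.expectedPulls H θ k T with hndef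
  suffices h : Real.log T ≤ 20 * L + (8 + 16 / (σ : ℝ) ^ 2) * (θ.gap k ^ 2 * n) by
    rw [div_le_iff₀ hg]
    refine h.trans_eq ?_
    field_simp
  have hgn : 0 ≤ θ.gap k ^ 2 * n := by positivity
  have h16 : 0 ≤ 16 / (σ : ℝ) ^ 2 := by positivity
  have hprod := mul_nonneg h16 hgn
  -- For short horizons the additive term suffices. Beyond them, `√T` dominates `1 / ε ^ 2`, so that
  -- linearly many pulls also give the claim, and the additive terms of the information bound are at
  -- most a fixed fraction of `log T`.
  by_cases hbig : Real.log T ≤ 20 * L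
  · linarith
  push Not at hbig
  have hT0 : (0 : ℝ) < T := by exact_mod_cast hT
  have hT2 : 2 ≤ T := by
    by_contra! hlt
    obtain rfl : T = 1 := by omega
    rw [Nat.cast_one, Real.log_one] at hbig
    linarith
  set d := θ.gap k + ε with hd
  have hmd : θ.mean k + d = θ.bestMean + ε := by
    rw [hd, Problem.gap]
    ring
  let ρ : ProbabilityMeasure ℝ := ⟨gaussianReal (θ.bestMean + ε) (σ ^ 2), inferInstance⟩
  have hlb := pulls_lower_bound (ρ := ρ) hθ hm hk integral_id_gaussianReal
    (hasSubgaussianMGF_gaussianReal σ _)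
    (g := fun x => (d ^ 2 / 2 - d * (x - θ.mean k)) / (σ : ℝ) ^ 2) (by fun_prop)
    (by rw [hgauss k]; exact (integral_gaussian_logRatio σ (θ.mean k) d).1)
    (by
      rw [hgauss k, gaussianReal_withDensity_shift hσ, hmd]
      exact le_rfl) π hC hπ hT2
  have hD : ∫ x, (d ^ 2 / 2 - d * (x - θ.mean k)) / (σ : ℝ) ^ 2 ∂(θ.ν k : Measure ℝ) =
      d ^ 2 / (2 * σ ^ 2) := by
    rw [hgauss k]
    exact (integral_gaussian_logRatio σ (θ.mean k) d).2
  rw [hD, ← hndef] at hlb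
  rcases hlb with h | h
  · set r := √(T : ℝ) with hr
    have hr0 : 0 < r := Real.sqrt_pos.mpr hT0
    have hrT : r ^ 2 = T := Real.sq_sqrt hT0.le
    have hlogr : Real.log T = 2 * Real.log r := by
      rw [← hrT, Real.log_pow]
      norm_num
    have hrε : (1 / ε) ^ 2 ≤ r := by
      refine (pow_le_pow_left₀ hiε.le (show 1 / ε ≤ 1 + 1 / ε by linarith) 2).trans ?_
      rw [← Real.log_le_log_iff (by positivity) hr0, Real.log_pow]
      push_cast
      linarith
    have h1 : 1 ≤ r * ε ^ 2 := by
      rw [div_pow, one_pow, div_le_iff₀ (by positivity)] at hrε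
      exact hrε
    have h2 : r ≤ T * ε ^ 2 := by
      rw [← hrT]
      nlinarith
    have h3 : Real.log T ≤ 2 * r := by
      rw [hlogr]
      linarith [Real.log_le_sub_one_of_pos hr0]
    have h4 : T / 4 * ε ^ 2 ≤ n * θ.gap k ^ 2 :=
      mul_le_mul h (pow_le_pow_left₀ hε.le hgε 2) (by positivity) hn
    linarith
  · have hlog8 : Real.log (8 * K * C / ε ^ 2) ≤ 3 * L := by
      rw [Real.log_div (by positivity) (by positivity), Real.log_mul (by positivity) hC.ne',
        Real.log_mul (by norm_num) (by positivity), Real.log_pow]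
      have e1 : Real.log 8 ≤ 3 := by
        rw [show (8 : ℝ) = 2 ^ 3 by norm_num, Real.log_pow]
        push_cast
        linarith [Real.log_two_lt_d9]
      have e2 : Real.log C ≤ Real.log (1 + C) := Real.log_le_log hC (by linarith)
      have e3 : -Real.log ε ≤ Real.log (1 + 1 / ε) := by
        rw [← Real.log_inv, ← one_div]
        exact Real.log_le_log hiε (by linarith)
      push_cast
      linarith
    -- The margin satisfies `ε ≤ gap`, so the shift `d = gap + ε` is at most twice the gap.
    have hdd : d ^ 2 / (2 * (σ : ℝ) ^ 2) * n ≤ 2 / (σ : ℝ) ^ 2 * (θ.gap k ^ 2 * n) := by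
      have e1 : d ^ 2 ≤ 4 * θ.gap k ^ 2 := by nlinarith
      have e2 : 2 / (σ : ℝ) ^ 2 * (θ.gap k ^ 2 * n) =
          4 * θ.gap k ^ 2 / (2 * (σ : ℝ) ^ 2) * n := by
        field_simp
        ring
      rw [e2]
      gcongr
    have e3 : 16 / (σ : ℝ) ^ 2 * (θ.gap k ^ 2 * n) =
        8 * (2 / (σ : ℝ) ^ 2 * (θ.gap k ^ 2 * n)) := by ring
    linarith

end Optimality

end AuxBandit

theorem theorem4 (σ : NNReal) (hσ : 0 < σ) (c : ℝ) (hc : 2 < c) (B : ℝ) (hB : 0 < B) :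
    ∃ C₁ C₂ C₃ C₄ : ℝ, 0 < C₁ ∧ 0 < C₂ ∧ 0 < C₃ ∧ 0 < C₄ ∧
      ∀ (K : ℕ) [NeZero K] (alo ahi Δ : ℝ), 0 ≤ alo → alo ≤ ahi → 0 ≤ Δ →
      ∀ H : ℕ → Fin K → ℕ, (∀ k, H 0 k = 1) →
        -- the regret bound
        (∀ θ ∈ AuxBandit.problemClass K σ alo ahi Δ B, ∀ T : ℕ, 1 ≤ T →
          (AuxBandit.ucb1Plus.{u} K σ ahi c).regret H θ T ≤
            ∑ k ∈ θ.contenders ahi, C₁ / θ.gap k ^ 2 * Real.log T +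
              (C₂ + ∑ k, θ.gap k)) ∧
        -- UCB1+ is itself information-agnostic-optimal
        (AuxBandit.ucb1Plus.{u} K σ ahi c).IsIAOWith H
          (AuxBandit.problemClass K σ alo ahi Δ B) C₃ ∧
        -- optimality, for all reward laws, up to a factor that does not depend on `T`
        (∀ θ ∈ AuxBandit.problemClass K σ alo ahi Δ B,
          (∃ ε, AuxBandit.HasMargin θ ahi Δ B ε) → (θ.contenders ahi).Nonempty →
          ∃ M : ℝ, 0 < M ∧ ∀ π : AuxBandit.Policy.{u} K,
            π.IsIAO H (AuxBandit.problemClass K σ alo ahi Δ B) →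
            ∃ T₀ : ℕ, ∀ T : ℕ, T₀ ≤ T →
              (AuxBandit.ucb1Plus.{u} K σ ahi c).regret H θ T ≤ M * π.regret H θ T) ∧
        -- optimality, for Gaussian rewards, up to a factor logarithmic in `K` and the gaps
        ∀ θ ∈ AuxBandit.problemClass K σ alo ahi Δ B,
          (∀ k, (θ.ν k : MeasureTheory.Measure ℝ) =
            ProbabilityTheory.gaussianReal (θ.mean k) (σ ^ 2)) →
          ∀ ε : ℝ, AuxBandit.HasMargin θ ahi Δ B ε →
          ∀ (π : AuxBandit.Policy.{u} K) (C : ℝ), 0 < C →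
            π.IsIAOWith H (AuxBandit.problemClass K σ alo ahi Δ B) C →
            ∀ T : ℕ, 1 ≤ T →
              (AuxBandit.ucb1Plus.{u} K σ ahi c).regret H θ T ≤
                C₄ * (1 + Real.log K + Real.log (1 + C) + Real.log (1 + 1 / ε)) *
                  (π.regret H θ T + 1 + ∑ k, θ.gap k +
                    ∑ k ∈ θ.contenders ahi, 1 / θ.gap k) := by

  classical
  obtain ⟨A, F, C, hA, hF, hC, hbounds⟩ := AuxBandit.exists_ucb1Plus_bounds.{u} σ hσ hc hB
  have hσ' : (0 : ℝ) < σ := hσ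
  refine ⟨A * B, F, C, 20 * A + A * (8 + 16 / (σ : ℝ) ^ 2) + F + 1, by positivity, hF, hC,
    by positivity, fun K _ alo ahi Δ _ _ _ H hH => ?_⟩
  obtain ⟨hreg, hiao⟩ := hbounds K alo ahi Δ H hH
  have hl2 : 0 < Real.log 2 := Real.log_pos (by norm_num)
  have hlogT : ∀ T : ℕ, 1 ≤ T → 0 ≤ Real.log T := fun T hT =>
    Real.log_nonneg (by exact_mod_cast hT)
  have hgpos : ∀ θ ∈ AuxBandit.problemClass K σ alo ahi Δ B, ∀ k ∈ θ.contenders ahi,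
      0 < θ.gap k := fun θ hθ k hk => (hθ.2.2.2.1 k (θ.mem_contenders.mp hk).1).1
  refine ⟨fun θ hθ T hT => ?_, hiao, ?_, ?_⟩
  · refine (hreg θ hθ T hT).trans (add_le_add (Finset.sum_le_sum fun k hk => ?_) le_rfl)
    refine mul_le_mul_of_nonneg_right ?_ (hlogT T hT)
    have hg := hgpos θ hθ k hk
    -- The bound proved for UCB1+ has `1 / gap`; the stated `1 / gap ^ 2` follows from `gap ≤ B`.
    rw [div_le_div_iff₀ hg (by positivity)]
    have := mul_le_mul_of_nonneg_left (hθ.2.2.2.2 k) (mul_pos hA hg).le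
    nlinarith
  · rintro θ hθ ⟨ε, hm⟩ ⟨k, hk⟩
    obtain ⟨r, hr, hrate⟩ := AuxBandit.exists_pulls_rate.{u} (H := H) hσ hθ hm hk
    have hg := hgpos θ hθ k hk
    have hsum0 : 0 ≤ ∑ j, θ.gap j := Finset.sum_nonneg fun j _ => θ.gap_nonneg j
    have hsumA : 0 ≤ ∑ j ∈ θ.contenders ahi, A / θ.gap j :=
      Finset.sum_nonneg fun j _ => div_nonneg hA.le (θ.gap_nonneg j)
    set A' := ∑ j ∈ θ.contenders ahi, A / θ.gap j + (F + ∑ j, θ.gap j) / Real.log 2 with hA'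
    have hA'0 : 0 < A' := by positivity
    -- `A' * log T` bounds the regret of UCB1+ for `2 ≤ T`, and `gap * r * log T` bounds the regret
    -- of any IAO policy from below for large `T`; a single contender is enough.
    refine ⟨A' / (θ.gap k * r), by positivity, fun π hπ => ?_⟩
    obtain ⟨T₀, hT₀⟩ := hrate π hπ
    refine ⟨max T₀ 2, fun T hT => ?_⟩
    have hT2 : 2 ≤ T := (le_max_right _ _).trans hT
    have hpulls := hT₀ T ((le_max_left _ _).trans hT)
    have hlog2 : Real.log 2 ≤ Real.log T :=
      Real.log_le_log (by norm_num) (by exact_mod_cast hT2)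
    have h1 : (AuxBandit.ucb1Plus.{u} K σ ahi c).regret H θ T ≤ A' * Real.log T := by
      refine (hreg θ hθ T (by omega)).trans ?_
      rw [hA', add_mul, Finset.sum_mul]
      refine add_le_add le_rfl ?_
      rw [div_mul_eq_mul_div, le_div_iff₀ hl2]
      exact mul_le_mul_of_nonneg_left hlog2 (by positivity)
    have h2 : θ.gap k * (r * Real.log T) ≤ π.regret H θ T := by
      refine (mul_le_mul_of_nonneg_left hpulls hg.le).trans
        (le_trans ?_ (AuxBandit.sum_contenders_gap_mul_pulls_le π θ ahi H T))
      exact Finset.single_le_sum (f := fun k => θ.gap k * π.expectedPulls H θ k T)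
        (fun j _ => mul_nonneg (θ.gap_nonneg j) (π.expectedPulls_nonneg H θ j T)) hk
    refine h1.trans ?_
    have h3 := mul_le_mul_of_nonneg_left h2 (show 0 ≤ A' / (θ.gap k * r) by positivity)
    refine le_trans (le_of_eq ?_) h3
    field_simp
  · intro θ hθ hgauss ε hm π C' hC' hπ T hT
    have hK1 : (1 : ℝ) ≤ K := by exact_mod_cast Nat.one_le_iff_ne_zero.mpr (NeZero.ne K)
    have hlK : 0 ≤ Real.log K := Real.log_nonneg hK1
    have hlC : 0 ≤ Real.log (1 + C') := Real.log_nonneg (by linarith)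
    have hiε : 0 < 1 / ε := one_div_pos.mpr hm.1
    have hlε : 0 ≤ Real.log (1 + 1 / ε) := Real.log_nonneg (by linarith)
    set L := 1 + Real.log K + Real.log (1 + C') + Real.log (1 + 1 / ε) with hL
    have hL1 : 1 ≤ L := by linarith
    have hgaps := AuxBandit.sum_contenders_gap_mul_pulls_le π θ ahi H T
    have hgn0 : 0 ≤ ∑ k ∈ θ.contenders ahi, θ.gap k * π.expectedPulls H θ k T :=
      Finset.sum_nonneg fun j _ => mul_nonneg (θ.gap_nonneg j) (π.expectedPulls_nonneg H θ j T)
    set R := π.regret H θ T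
    have hR0 : 0 ≤ R := hgn0.trans hgaps
    set G := ∑ k, θ.gap k with hG
    have hG0 : 0 ≤ G := Finset.sum_nonneg fun j _ => θ.gap_nonneg j
    set I := ∑ k ∈ θ.contenders ahi, 1 / θ.gap k with hI
    have hI0 : 0 ≤ I := Finset.sum_nonneg fun j _ => one_div_nonneg.mpr (θ.gap_nonneg j)
    set c5 := 8 + 16 / (σ : ℝ) ^ 2 with hc5
    have hc50 : 0 < c5 := by positivity
    have hsum : ∑ k ∈ θ.contenders ahi, A / θ.gap k * Real.log T ≤ A * (20 * L * I + c5 * R) := by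
      have h1 : ∀ k ∈ θ.contenders ahi, A / θ.gap k * Real.log T ≤
          A * (20 * L * (1 / θ.gap k) + c5 * (θ.gap k * π.expectedPulls H θ k T)) :=
        fun k hk => by
          rw [div_mul_eq_mul_div, mul_div_assoc]
          exact mul_le_mul_of_nonneg_left
            (AuxBandit.log_div_gap_le_of_gaussian hσ hθ hgauss hm hk π hC' hπ hT) hA.le
      refine (Finset.sum_le_sum h1).trans ?_
      rw [← Finset.mul_sum, Finset.sum_add_distrib, ← Finset.mul_sum, ← Finset.mul_sum]
      exact mul_le_mul_of_nonneg_left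
        (add_le_add le_rfl (mul_le_mul_of_nonneg_left hgaps hc50.le)) hA.le
    refine (hreg θ hθ T hT).trans ((add_le_add hsum le_rfl).trans ?_)
    -- Only the term `20 * A * L * I` carries the factor `L`; its excess over `20 * A * I` is set
    -- aside here, and the other terms use `1 ≤ L`.
    have hS : (20 * A + A * c5 + F + 1) * (R + 1 + G + I) ≤
        (20 * A + A * c5 + F + 1) * L * (R + 1 + G + I) - 20 * A * (L - 1) * I := by
      have h1 : 0 ≤ (L - 1) * ((20 * A + A * c5 + F + 1) * (R + 1 + G) +
          (A * c5 + F + 1) * I) := mul_nonneg (by linarith) (by positivity)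
      nlinarith
    have h2 : A * (20 * L * I + c5 * R) + (F + G) ≤
        (20 * A + A * c5 + F + 1) * (R + 1 + G + I) + 20 * A * (L - 1) * I := by
      have h3 : 0 ≤ 20 * A * (R + 1 + G) + A * c5 * (1 + G + I) + F * (R + G + I) +
        (R + 1 + I) := by positivity
      nlinarith
    linarith
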